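/- **Setting.** Let $\mathbb K$ be a non-archimedean local field with ring of integers $\mathcal O$, maximal ideal $\mathfrak p$, residue field of cardinality $q$, and normalised absolute value $|\cdot|_{\mathbb K}$ (a uniformiser has absolute value $q^{-1}$). Let $\mathfrak g=\bigoplus_{k\ge1}V_k$ be a finite-dimensional nilpotent graded $\mathbb K$-Lie algebra, $[V_i,V_j]\subseteq V_{i+j}$, with homogeneous dimension $Q=\sum_k k\dim V_k$. If $\mathbb K$ has positive characteristic $p$, assume that the nilpotency class of $\mathfrak g$ is less than $p$. Let $G$ be a graded $\mathbb K$-Lie group with Lie algebra $\mathfrak g$: a topological group with a homeomorphism $\exp:\mathfrak g\to G$ under which the group law is the Baker–Campbell–Hausdorff product. Let $D_\gamma$ ($\gamma\in\mathbb K^*$) be the linear map of $\mathfrak g$ acting on $V_k$ as multiplication by $\gamma^k$, and write $\gamma x=\exp(D_\gamma\exp^{-1}x)$ for $x\in G$. Let $X_1,\dots,X_d$ be a basis of $\mathfrak g$ with $X_i\in V_{\nu_i}$, put $G_n=\exp(\mathfrak p^{n\nu_1}X_1+\dots+\mathfrak p^{n\nu_d}X_d)$ for $n\in\mathbb Z$,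 and let $dx$ be the Haar measure of $G$ with $|G_0|=1$. Put $|e|_G=0$, $|x|_G=|G_n|^{1/Q}$ for $x\in G_n\setminus G_{n+1}$, and $B(e,R)=\{z\in G:|z|_G\le R\}$. For $S=G$ or $S=G_0$, a *weight on $S$ of degree $\kappa\in\mathbb R$* is a function $w$ on $S$ that on $S\setminus\{e\}$ is continuous, has values in $[0,\infty)$, and satisfies $w(\gamma x)=|\gamma|_{\mathbb K}^{\kappa}w(x)$ for all $\gamma\in\mathbb K^*$ and $x\in S\setminus\{e\}$ with $\gamma x\in S$. Let $1<r\le s<\infty$, $\frac1r+\frac1{r'}=1$, $\alpha>Q$ and $\beta<Q/(r'-1)$. Let $\varphi$ and $\psi$ be weights on $S$ of degrees $-\alpha$ and $\beta$ such that $\varphi$ does not vanish identically on $S\setminus\{e\}$ and $\int_{G_0\setminus G_1}\psi^{1-r'}dx<\infty$, where $0^{1-r'}=\infty$ (this holds in particular if $\psi>0$ on $S\setminus\{e\}$). Consider the statement $(*)_S$: there is a constant $C>0$ such that for every measurable $f$ on $S$ with $f\ge0$ a.e., $$\Big(\int_S\Big(\int_{S\cap B(e,|x|_G)}f(z)\,dz\Big)^s\varphi(x)\,dx\Big)^{1/s}\le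 C\Big(\int_S f(x)^r\psi(x)\,dx\Big)^{1/r}.$$ **Theorem.** 1. Let $S=G$ and $\beta\ge0$. Then $(*)_G$ holds if and only if $\dfrac{\alpha-Q}{s}=\dfrac{Q}{r'}-\dfrac{\beta}{r}$. 2. Let $S=G_0$ (the compact case). If $\dfrac{\alpha-Q}{s}=\dfrac{Q}{r'}-\dfrac{\beta}{r}$, then $(*)_{G_0}$ holds. If $(*)_{G_0}$ holds, then $\dfrac{\alpha-Q}{s}\le\dfrac{Q}{r'}-\dfrac{\beta}{r}$. -/

import Mathlib

open MeasureTheory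
open scoped ENNReal

noncomputable section

namespace GradedHardy

/-! ### The local field `K` -/

section LocalField

variable (K : Type*) [Field K] [ValuativeRel K] [TopologicalSpace K]
  [IsNonarchimedeanLocalField K]

/-- The cardinality `q` of the residue field of `K`. -/
def residueCard : ℕ :=
  Nat.card (IsLocalRing.ResidueField (ValuativeRel.valuation K).integer)

variable {K}

/-- The normalised absolute value on `K`: `|0| = 0` and `|γ| = q ^ (-n)` if `γ` is a unit times the
`n`-th power of a uniformiser. -/
def absK (γ : K) : ℝ :=
  open Classical in
  if γ = 0 then 0 else
    (residueCard K : ℝ) ^ WithZero.log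
      (IsNonarchimedeanLocalField.valueGroupWithZeroIsoInt K (ValuativeRel.valuation K γ))

end LocalField

/-! ### The Baker-Campbell-Hausdorff product of a nilpotent Lie algebra -/

/-- The right-nested bracket `[x₁, [x₂, …, [xₖ₋₁, xₖ]…]]` of a list `x₁, …, xₖ`. -/
def nestedBracket {𝔤 : Type*} [LieRing 𝔤] : List 𝔤 → 𝔤
  | [] => 0
  | [x] => x
  | x :: y :: l => ⁅x, nestedBracket (y :: l)⁆

section BCH

variable (K : Type*) {𝔤 : Type*} [Field K] [LieRing 𝔤] [LieAlgebra K 𝔤]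

/-- The part of total degree `m` of Dynkin's formula for `log (exp X * exp Y)`:
`∑ₙ (-1) ^ (n - 1) / n * ∑ (m ∏ᵢ rᵢ! sᵢ!)⁻¹ [X ^ r₁ Y ^ s₁ ⋯ X ^ rₙ Y ^ sₙ]`, where the inner sum is
over `(rᵢ, sᵢ)`, `i = 1, …, n`, with `rᵢ + sᵢ > 0` and `∑ (rᵢ + sᵢ) = m`. -/
def bchTerm (m : ℕ) (X Y : 𝔤) : 𝔤 :=
  ∑ n ∈ Finset.Icc 1 m, ((-1 : K) ^ (n - 1) / (n : K)) •
    ∑ p : Fin n → Fin (m + 1) × Fin (m + 1) with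
        (∀ i, 0 < ((p i).1 : ℕ) + ((p i).2 : ℕ)) ∧
          ∑ i, (((p i).1 : ℕ) + ((p i).2 : ℕ)) = m,
      ((m : K) * ∏ i, (((p i).1 : ℕ).factorial : K) * (((p i).2 : ℕ).factorial : K))⁻¹ •
        nestedBracket ((List.ofFn p).flatMap fun a =>
          List.replicate (a.1 : ℕ) X ++ List.replicate (a.2 : ℕ) Y)

/-- The Baker-Campbell-Hausdorff product of a nilpotent Lie algebra: brackets of more elements than
the nilpotency class vanish, so the series stops there. -/
def bch (X Y : 𝔤) : 𝔤 :=
  ∑ m ∈ Finset.Icc 1 (LieModule.nilpotencyLength 𝔤 𝔤), bchTerm K m X Y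

end BCH

/-! ### Graded Lie groups over `K` -/

section Grading

variable {K 𝔤 : Type*} [Field K] [LieRing 𝔤] [LieAlgebra K 𝔤]

/-- The homogeneous dimension `Q = ∑ₖ k dim Vₖ`. -/
def homogeneousDim (V : ℕ → Submodule K 𝔤) : ℕ :=
  ∑ᶠ k : ℕ, k * Module.finrank K (V k)

/-- The dilation `D_γ` of the Lie algebra: multiplication by `γ ^ k` on `Vₖ`. -/
def lieDilation (V : ℕ → Submodule K 𝔤) [GradedLieAlgebra V] (γ : K) : 𝔤 →ₗ[K] 𝔤 :=
  DirectSum.toModule K ℕ 𝔤 (fun k => γ ^ k • (V k).subtype) ∘ₗ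
    (DirectSum.decomposeLinearEquiv V).toLinearMap

end Grading

/-- The structure of a graded Lie group over the local field `K`, with Lie algebra `𝔤` graded by
the subspaces `V 1, V 2, …` (the rule `⁅V i, V j⁆ ⊆ V (i + j)` and the direct sum decomposition are
part of `GradedLieAlgebra V`), on the topological group `G`. The group is given by its exponential
map, a homeomorphism of `𝔤` onto `G` under which the group law is the
Baker-Campbell-Hausdorff product. A basis `X₁, …, X_d` of homogeneous vectors, `Xᵢ ∈ V (νᵢ)`, is
fixed as well.

The condition `natCast_ne_zero` says that the denominators in the Baker-Campbell-Hausdorff product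
are invertible; it holds automatically in characteristic zero. -/
structure GradedLieGroup (K 𝔤 G : Type*) [Field K] [ValuativeRel K] [TopologicalSpace K]
    [IsNonarchimedeanLocalField K] [LieRing 𝔤] [LieAlgebra K 𝔤] [LieRing.IsNilpotent 𝔤]
    [TopologicalSpace 𝔤] [IsModuleTopology K 𝔤] [Group G] [TopologicalSpace G]
    [IsTopologicalGroup G] (V : ℕ → Submodule K 𝔤) [GradedLieAlgebra V] (d : ℕ) where
  V_zero : V 0 = ⊥
  natCast_ne_zero : ∀ k : ℕ, 0 < k → k ≤ LieModule.nilpotencyLength 𝔤 𝔤 → (k : K) ≠ 0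
  exp : 𝔤 ≃ₜ G
  exp_bch : ∀ X Y : 𝔤, exp (bch K X Y) = exp X * exp Y
  basis : Module.Basis (Fin d) K 𝔤
  weight : Fin d → ℕ
  basis_mem : ∀ i, basis i ∈ V (weight i)

namespace GradedLieGroup

variable {K 𝔤 G : Type*} [Field K] [ValuativeRel K] [TopologicalSpace K]
  [IsNonarchimedeanLocalField K] [LieRing 𝔤] [LieAlgebra K 𝔤] [LieRing.IsNilpotent 𝔤]
  [TopologicalSpace 𝔤] [IsModuleTopology K 𝔤] [Group G] [TopologicalSpace G]
  [IsTopologicalGroup G] {V : ℕ → Submodule K 𝔤} [GradedLieAlgebra V] {d : ℕ}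

/-- The dilation `exp ∘ D_γ ∘ exp⁻¹` of the group. -/
def dilation (𝒢 : GradedLieGroup K 𝔤 G V d) (γ : K) (x : G) : G :=
  𝒢.exp (lieDilation V γ (𝒢.exp.symm x))

/-- The set `G_n = exp (𝔭 ^ (n ν₁) X₁ + ⋯ + 𝔭 ^ (n ν_d) X_d)`, `n ∈ ℤ`, where `𝔭 ^ j` is the
fractional ideal `{t ∈ K | |t| ≤ q ^ (-j)}`. -/
def filtration (𝒢 : GradedLieGroup K 𝔤 G V d) (n : ℤ) : Set G :=
  {x | ∀ i, absK (𝒢.basis.repr (𝒢.exp.symm x) i) ≤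
    (residueCard K : ℝ) ^ (-(n * (𝒢.weight i : ℤ)))}

variable [MeasurableSpace G]

/-- The quasi-norm: `|e| = 0` and `|x| = |G_n| ^ (1 / Q)` if `x ∈ G_n \ G_{n+1}`. -/
def qnorm (𝒢 : GradedLieGroup K 𝔤 G V d) (μ : Measure G) (x : G) : ℝ :=
  open Classical in
  if h : ∃ n : ℤ, x ∈ 𝒢.filtration n \ 𝒢.filtration (n + 1) then
    μ.real (𝒢.filtration h.choose) ^ (1 / (homogeneousDim V : ℝ))
  else 0

/-- The ball `B(e, R) = {z | |z| ≤ R}`. -/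
def ball (𝒢 : GradedLieGroup K 𝔤 G V d) (μ : Measure G) (R : ℝ) : Set G :=
  {z | 𝒢.qnorm μ z ≤ R}

/-- `w` is a nonnegative weight on `S \ {e}`, continuous there and homogeneous of degree `κ`. -/
structure IsHomogeneousWeight (𝒢 : GradedLieGroup K 𝔤 G V d) (S : Set G) (κ : ℝ)
    (w : G → ℝ) : Prop where
  nonneg : ∀ x ∈ S \ {1}, 0 ≤ w x
  continuousOn : ContinuousOn w (S \ {1})
  homogeneous : ∀ γ : K, γ ≠ 0 → ∀ x ∈ S \ {1}, 𝒢.dilation γ x ∈ S →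
    w (𝒢.dilation γ x) = absK γ ^ κ * w x

/-- The weighted inequality on `S` (which is `G` or `G_0`) for all measurable functions `f` that
are nonnegative almost everywhere on `S`, with a constant `C` independent of `f`. -/
def HardyInequality (𝒢 : GradedLieGroup K 𝔤 G V d) (μ : Measure G) (S : Set G) (r s : ℝ)
    (φ ψ : G → ℝ) : Prop :=
  ∃ C : ℝ, 0 < C ∧ ∀ f : G → ℝ, AEMeasurable f (μ.restrict S) →
    (∀ᵐ x ∂μ.restrict S, 0 ≤ f x) →
    (∫⁻ x in S, (∫⁻ z in S ∩ 𝒢.ball μ (𝒢.qnorm μ x), ENNReal.ofReal (f z) ∂μ) ^ s *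
        ENNReal.ofReal (φ x) ∂μ) ^ (1 / s) ≤
      ENNReal.ofReal C *
        (∫⁻ x in S, ENNReal.ofReal (f x) ^ r * ENNReal.ofReal (ψ x) ∂μ) ^ (1 / r)

end GradedLieGroup

end GradedHardy

end

/-!
The group `G` is cut into the shells `A_n = G_n \ G_{n+1}`, `n ∈ ℤ`, on which everything scales. A
uniformiser `π` gives the dilation by `π ^ n`, an automorphism of the topological group `G` that
carries `A_0` onto `A_n`, so that the integral of a weight of degree `κ` over `A_n` is
`q ^ (-n (Q + κ))` times its integral over `A_0`. The ball `B(e, |x|)` of a point `x ∈ A_n` is `G_n`, the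
union of `{e}` and the shells `A_{n+j}`, `j ≥ 0`. Put `δ = Q / r' - β / r`, which is positive.

*Sufficiency* (`hardyInequality_of_eq`). With `b_n` the norm of `f` in `L ^ r (A_n, ψ)`, Hölder's
inequality gives `∫_{A_n} f ≤ c q ^ (-n δ) b_n`. If `(α - Q) / s = δ`, the powers of `q` cancel
and what remains is an inequality for sequences,
`‖∑ⱼ q ^ (-j δ) b_{n+j}‖_{ℓ ^ s} ≤ c ‖b‖_{ℓ ^ r}`, which holds since `δ > 0` and `r ≤ s` (`tsum_rpow_geometric_le`).

*Necessity* (`exists_rpow_le_of_hardyInequality`). For the indicator function of `A_n` the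
inequality reads `q ^ (n ((α - Q) / s - δ)) ≤ M` with `M` independent of `n`. On `G` all integers
`n` are allowed, which forces equality; on `G_0` only `n ≥ 0`, which gives one inequality.

The scaling rests on the fact that the dilation by `π` multiplies the Haar measure of `G` by
`q ^ (-Q)` (`map_shift`). As it is an automorphism, it multiplies the Haar measure by a constant, and
the constant can be computed on one small set. The lattices `∑ 𝔭 ^ (eᵢ) Xᵢ` need not be subgroups
for the Baker-Campbell-Hausdorff product, but if `L` is a lattice close to `0`, then for `X ∈ L`
and a smaller lattice `M = ∑ 𝔭 ^ j Xᵢ` one has `exp X * exp M = exp (X + M)`: the brackets of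
degree at least two gain more powers of `𝔭` than the denominators of their coefficients lose
(`exists_bch_sub_bch_mem_lattice`, `exists_exp_add_lattice`). So the Haar measure of `exp L` is
`[L : M]` times that of `exp M`, and the constant is the inverse of an index of lattices.
-/

namespace GradedHardy

/-! ### The normalised absolute value -/

section LocalField

open ValuativeRel IsNonarchimedeanLocalField

variable (K : Type*) [Field K] [ValuativeRel K] [TopologicalSpace K]
  [IsNonarchimedeanLocalField K]

theorem one_lt_residueCard : (1 : ℝ) < residueCard K := by
  have : Finite (IsLocalRing.ResidueField (valuation K).integer) :=
    inferInstanceAs (Finite 𝓀[K])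
  have h : 1 < Nat.card (IsLocalRing.ResidueField (valuation K).integer) :=
    Finite.one_lt_card
  exact_mod_cast h

theorem residueCard_pos : (0 : ℝ) < residueCard K := zero_lt_one.trans (one_lt_residueCard K)

theorem residueCard_rpow_mul_rpow (x y : ℝ) :
    (residueCard K : ℝ≥0∞) ^ x * (residueCard K : ℝ≥0∞) ^ y = (residueCard K : ℝ≥0∞) ^ (x + y) := by
  have h : residueCard K ≠ 0 := by exact_mod_cast (residueCard_pos K).ne'
  exact (ENNReal.rpow_add x y (by exact_mod_cast h) (ENNReal.natCast_ne_top _)).symm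

theorem residueCard_rpow_ne_top (x : ℝ) : (residueCard K : ℝ≥0∞) ^ x ≠ ∞ := by
  have h : residueCard K ≠ 0 := by exact_mod_cast (residueCard_pos K).ne'
  simp [ENNReal.rpow_eq_top_iff, h]

theorem ofReal_residueCard_rpow (x : ℝ) :
    ENNReal.ofReal ((residueCard K : ℝ) ^ x) = (residueCard K : ℝ≥0∞) ^ x := by
  rw [← ENNReal.ofReal_rpow_of_pos (residueCard_pos K), ENNReal.ofReal_natCast]

variable {K}

theorem absK_zero : absK (0 : K) = 0 := by simp [absK]

theorem absK_of_ne_zero {x : K} (hx : x ≠ 0) :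
    absK x = (residueCard K : ℝ) ^ WithZero.log (valueGroupWithZeroIsoInt K (valuation K x)) := by
  simp [absK, hx]

theorem absK_pos {x : K} (hx : x ≠ 0) : 0 < absK x := by
  rw [absK_of_ne_zero hx]
  exact zpow_pos (residueCard_pos K) _

theorem absK_nonneg (x : K) : 0 ≤ absK x := by
  rcases eq_or_ne x 0 with rfl | hx
  · rw [absK_zero]
  · exact (absK_pos hx).le

theorem valueGroupWithZeroIsoInt_valuation_ne_zero {x : K} (hx : x ≠ 0) :
    valueGroupWithZeroIsoInt K (valuation K x) ≠ 0 := by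
  simpa using hx

theorem absK_le_absK_iff {x y : K} : absK x ≤ absK y ↔ valuation K x ≤ valuation K y := by
  rcases eq_or_ne x 0 with rfl | hx
  · simp [absK_zero, absK_nonneg]
  rcases eq_or_ne y 0 with rfl | hy
  · simpa [absK_zero, hx] using absK_pos hx
  rw [absK_of_ne_zero hx, absK_of_ne_zero hy, zpow_le_zpow_iff_right₀ (one_lt_residueCard K),
    WithZero.log_le_log (valueGroupWithZeroIsoInt_valuation_ne_zero hx)
      (valueGroupWithZeroIsoInt_valuation_ne_zero hy)]
  exact (valueGroupWithZeroIsoInt K).toOrderIso.le_iff_le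

theorem absK_lt_absK_iff {x y : K} : absK x < absK y ↔ valuation K x < valuation K y := by
  rw [← not_le, absK_le_absK_iff, not_le]

theorem absK_mul (x y : K) : absK (x * y) = absK x * absK y := by
  rcases eq_or_ne x 0 with rfl | hx
  · simp [absK_zero]
  rcases eq_or_ne y 0 with rfl | hy
  · simp [absK_zero]
  rw [absK_of_ne_zero hx, absK_of_ne_zero hy, absK_of_ne_zero (mul_ne_zero hx hy),
    ← zpow_add₀ (residueCard_pos K).ne', map_mul, map_mul,
    WithZero.log_mul (valueGroupWithZeroIsoInt_valuation_ne_zero hx)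
      (valueGroupWithZeroIsoInt_valuation_ne_zero hy)]

theorem absK_one : absK (1 : K) = 1 := by
  simp [absK_of_ne_zero (one_ne_zero (α := K))]

variable (K) in
/-- The normalised absolute value as a homomorphism of monoids with zero. -/
noncomputable def absKHom : K →*₀ ℝ where
  toFun := absK
  map_zero' := absK_zero
  map_one' := absK_one
  map_mul' := absK_mul

theorem absK_zpow (x : K) (n : ℤ) : absK (x ^ n) = absK x ^ n := map_zpow₀ (absKHom K) x n

theorem absK_neg (x : K) : absK (-x) = absK x :=
  le_antisymm (absK_le_absK_iff.2 (by simp)) (absK_le_absK_iff.2 (by simp))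

theorem absK_add_le_max (x y : K) : absK (x + y) ≤ max (absK x) (absK y) := by
  rw [le_max_iff, absK_le_absK_iff, absK_le_absK_iff, ← le_max_iff]
  exact (valuation K).map_add x y

theorem exists_absK_eq_zpow {x : K} (hx : x ≠ 0) : ∃ n : ℤ, absK x = (residueCard K : ℝ) ^ n :=
  ⟨_, absK_of_ne_zero hx⟩

variable (K) in
theorem exists_absK_eq_inv : ∃ x : K, x ≠ 0 ∧ absK x = (residueCard K : ℝ)⁻¹ := by
  obtain ⟨x, hx⟩ := valuation_surjective
    ((valueGroupWithZeroIsoInt K).symm (WithZero.exp (-1 : ℤ)))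
  have h0 : x ≠ 0 := by
    rintro rfl
    have := congrArg (valueGroupWithZeroIsoInt K) hx
    rw [map_zero, map_zero, OrderMonoidIso.apply_symm_apply] at this
    exact WithZero.exp_ne_zero this.symm
  refine ⟨x, h0, ?_⟩
  rw [absK_of_ne_zero h0, hx]
  simp

variable (K) in
/-- A uniformiser of `K`. -/
noncomputable def uniformizer : K := (exists_absK_eq_inv K).choose

theorem uniformizer_ne_zero : uniformizer K ≠ 0 := (exists_absK_eq_inv K).choose_spec.1

theorem absK_uniformizer_zpow (n : ℤ) :
    absK (uniformizer K ^ n) = (residueCard K : ℝ) ^ (-n) := by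
  rw [absK_zpow, uniformizer, (exists_absK_eq_inv K).choose_spec.2, inv_zpow, zpow_neg]

theorem uniformizer_zpow_ne_zero (n : ℤ) : uniformizer K ^ n ≠ 0 :=
  zpow_ne_zero n uniformizer_ne_zero

variable (K) in
/-- The fractional ideal `𝔭 ^ n = {x | |x| ≤ q ^ (-n)}` as an additive subgroup. -/
def fracIdeal (n : ℤ) : AddSubgroup K where
  carrier := {x | absK x ≤ (residueCard K : ℝ) ^ (-n)}
  zero_mem' := by
    simp only [Set.mem_ofPred_eq, absK_zero]
    exact (zpow_pos (residueCard_pos K) _).le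
  add_mem' {x y} hx hy := (absK_add_le_max x y).trans (max_le hx hy)
  neg_mem' {x} hx := by simpa [absK_neg] using hx

theorem mem_fracIdeal {n : ℤ} {x : K} :
    x ∈ fracIdeal K n ↔ absK x ≤ (residueCard K : ℝ) ^ (-n) := Iff.rfl

theorem fracIdeal_anti {m n : ℤ} (h : m ≤ n) : fracIdeal K n ≤ fracIdeal K m := fun _ hx =>
  le_trans (mem_fracIdeal.1 hx) (zpow_le_zpow_right₀ (one_lt_residueCard K).le (neg_le_neg h))

theorem mul_mem_fracIdeal {m n : ℤ} {x y : K} (hx : x ∈ fracIdeal K m) (hy : y ∈ fracIdeal K n) :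
    x * y ∈ fracIdeal K (m + n) := by
  rw [mem_fracIdeal, absK_mul, neg_add, zpow_add₀ (residueCard_pos K).ne']
  exact mul_le_mul hx hy (absK_nonneg y) (zpow_pos (residueCard_pos K) _).le

theorem exists_mem_fracIdeal (x : K) : ∃ n : ℕ, x ∈ fracIdeal K (-n) := by
  obtain ⟨n, hn⟩ := pow_unbounded_of_one_lt (absK x) (one_lt_residueCard K)
  exact ⟨n, by simpa [mem_fracIdeal] using hn.le⟩

theorem uniformizer_zpow_mul_mem_fracIdeal {m n : ℤ} {x : K} :
    uniformizer K ^ m * x ∈ fracIdeal K (m + n) ↔ x ∈ fracIdeal K n := by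
  rw [mem_fracIdeal, mem_fracIdeal, absK_mul, absK_uniformizer_zpow, neg_add,
    zpow_add₀ (residueCard_pos K).ne', mul_le_mul_iff_right₀ (zpow_pos (residueCard_pos K) _)]

/-! ### Topology of the field -/

theorem fracIdeal_eq_valuation_le (n : ℤ) :
    (fracIdeal K n : Set K) = {x | valuation K x ≤ valuation K (uniformizer K ^ n)} := by
  ext x
  rw [SetLike.mem_coe, mem_fracIdeal, ← absK_uniformizer_zpow, absK_le_absK_iff]
  rfl

theorem isCompact_fracIdeal (n : ℤ) : IsCompact (fracIdeal K n : Set K) := by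
  rw [fracIdeal_eq_valuation_le]
  exact isCompact_closedBall K _

theorem isOpen_fracIdeal (n : ℤ) : IsOpen (fracIdeal K n : Set K) := by
  apply AddSubgroup.isOpen_of_mem_nhds (g := 0)
  rw [(IsValuativeTopology.hasBasis_nhds_zero' K).mem_iff]
  refine ⟨valuation K (uniformizer K ^ n), (map_ne_zero _).2 (uniformizer_zpow_ne_zero n),
    fun x hx => ?_⟩
  rw [fracIdeal_eq_valuation_le]
  exact le_of_lt (Set.mem_ofPred_eq ▸ hx)

theorem hasBasis_nhds_zero_fracIdeal :
    (nhds (0 : K)).HasBasis (fun _ : ℕ => True) fun n => (fracIdeal K n : Set K) := by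
  refine ⟨fun t => ⟨fun ht => ?_, fun ⟨n, _, hn⟩ => Filter.mem_of_superset
    ((isOpen_fracIdeal n).mem_nhds (zero_mem _)) hn⟩⟩
  obtain ⟨γ, hγ, h⟩ := (IsValuativeTopology.hasBasis_nhds_zero' K).mem_iff.1 ht
  obtain ⟨y, rfl⟩ := valuation_surjective γ
  have hy : y ≠ 0 := by simpa using hγ
  obtain ⟨n, hn⟩ := exists_pow_lt_of_lt_one (absK_pos hy)
    (inv_lt_one_of_one_lt₀ (one_lt_residueCard K))
  refine ⟨n, trivial, fun x hx => h ?_⟩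
  change valuation K x < valuation K y
  rw [← absK_lt_absK_iff]
  refine lt_of_le_of_lt hx ?_
  simpa using hn

variable (K) in
theorem secondCountableTopology_localField : SecondCountableTopology K := by
  let := IsTopologicalAddGroup.rightUniformSpace K
  have := isUniformAddGroup_of_addCommGroup (G := K)
  have h1 : (nhds (0 : K)).IsCountablyGenerated := hasBasis_nhds_zero_fracIdeal.isCountablyGenerated
  have h2 : (uniformity K).IsCountablyGenerated := IsUniformAddGroup.uniformity_countably_generated
  have h3 : SigmaCompactSpace K := by
    refine ⟨⟨fun n : ℕ => (fracIdeal K (-n) : Set K), fun n => isCompact_fracIdeal _, ?_⟩⟩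
    exact Set.eq_univ_of_forall fun x => Set.mem_iUnion.2 (exists_mem_fracIdeal x)
  exact UniformSpace.secondCountable_of_separable K

variable (K) in
theorem t2Space_localField : T2Space K := by
  let := IsTopologicalAddGroup.rightUniformSpace K
  have := isUniformAddGroup_of_addCommGroup (G := K)
  infer_instance

/-! ### Indices of the fractional ideals -/

theorem relIndex_fracIdeal_one_zero :
    (fracIdeal K 1).relIndex (fracIdeal K 0) = residueCard K := by
  let ι : (valuation K).integer →+ K := (valuation K).integer.subtype.toAddMonoidHom
  let ρ : (valuation K).integer →+ IsLocalRing.ResidueField (valuation K).integer :=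
    (IsLocalRing.residue (valuation K).integer).toAddMonoidHom
  have hmap : (⊤ : AddSubgroup (valuation K).integer).map ι = fracIdeal K 0 := by
    ext x
    rw [mem_fracIdeal, neg_zero, zpow_zero, ← absK_one (K := K), absK_le_absK_iff, map_one]
    constructor
    · rintro ⟨y, -, rfl⟩
      exact y.2
    · exact fun h => ⟨⟨x, h⟩, trivial, rfl⟩
  have hker : (fracIdeal K 1).comap ι = ρ.ker := by
    ext x
    -- The value group is discrete, so that `|x| < 1` means `|x| ≤ q⁻¹`.
    have h1 : x ∈ ρ.ker ↔ x ∈ IsLocalRing.maximalIdeal (valuation K).integer :=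
      IsLocalRing.residue_eq_zero_iff x
    have h2 : x ∈ IsLocalRing.maximalIdeal (valuation K).integer ↔ valuation K (x : K) < 1 := by
      rw [IsLocalRing.mem_maximalIdeal, mem_nonunits_iff,
        Valuation.integer.integers (valuation K) |>.isUnit_iff_valuation_eq_one]
      exact ⟨fun h => lt_of_le_of_ne x.2 h, fun h => h.ne⟩
    have h3 : x ∈ (fracIdeal K 1).comap ι ↔ absK (x : K) ≤ (residueCard K : ℝ) ^ (-1 : ℤ) := Iff.rfl
    rw [h1, h2, h3, ← map_one (valuation K), ← absK_lt_absK_iff, absK_one]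
    constructor
    · exact fun h => h.trans_lt (by simpa using inv_lt_one_of_one_lt₀ (one_lt_residueCard K))
    · intro h
      rcases eq_or_ne (x : K) 0 with h0 | h0
      · rw [h0, absK_zero]
        exact (zpow_pos (residueCard_pos K) _).le
      obtain ⟨n, hn⟩ := exists_absK_eq_zpow h0
      rw [hn] at h ⊢
      rw [zpow_lt_one_iff_right₀ (one_lt_residueCard K)] at h
      exact zpow_le_zpow_right₀ (one_lt_residueCard K).le (by omega)
  rw [← hmap, ← AddSubgroup.relIndex_comap, hker, AddSubgroup.relIndex_top_right,
    AddSubgroup.index_ker, AddMonoidHom.range_eq_top_of_surjective ρ IsLocalRing.residue_surjective]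
  exact Nat.card_congr AddSubgroup.topEquiv.toEquiv

theorem map_mulLeft_fracIdeal (m n : ℤ) :
    (fracIdeal K n).map (AddMonoidHom.mulLeft (uniformizer K ^ m)) = fracIdeal K (m + n) := by
  ext x
  constructor
  · rintro ⟨y, hy, rfl⟩
    exact uniformizer_zpow_mul_mem_fracIdeal.2 hy
  · intro hx
    refine ⟨(uniformizer K ^ m)⁻¹ * x, ?_, ?_⟩
    · rw [SetLike.mem_coe, ← uniformizer_zpow_mul_mem_fracIdeal (m := m),
        mul_inv_cancel_left₀ (uniformizer_zpow_ne_zero m)]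
      exact hx
    · exact mul_inv_cancel_left₀ (uniformizer_zpow_ne_zero m) x

theorem relIndex_fracIdeal (n : ℤ) (k : ℕ) :
    (fracIdeal K (n + k)).relIndex (fracIdeal K n) = residueCard K ^ k := by
  induction k with
  | zero => simp
  | succ k ih =>
    have h : (fracIdeal K (n + (k + 1 : ℕ))).relIndex (fracIdeal K (n + k)) = residueCard K := by
      rw [show n + ((k + 1 : ℕ) : ℤ) = (n + k) + 1 by push_cast; ring]
      rw [← map_mulLeft_fracIdeal (n + k) 1]
      nth_rw 2 [← add_zero (n + (k : ℤ))]
      rw [← map_mulLeft_fracIdeal (n + k) 0, AddSubgroup.relIndex_map_map_of_injective _ _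
        (mul_right_injective₀ (uniformizer_zpow_ne_zero _)), relIndex_fracIdeal_one_zero]
    rw [← AddSubgroup.relIndex_mul_relIndex _ (fracIdeal K (n + k)) _
      (fracIdeal_anti (by push_cast; linarith)) (fracIdeal_anti (by linarith)), h, ih, pow_succ']

end LocalField

/-! ### Lattices in a finite-dimensional Lie algebra -/

section Lattice

variable {K 𝔤 : Type*} [Field K] [ValuativeRel K] [TopologicalSpace K]
  [IsNonarchimedeanLocalField K] [LieRing 𝔤] [LieAlgebra K 𝔤] {ι : Type*}

/-- The lattice `∑ᵢ 𝔭 ^ (eᵢ) Xᵢ` spanned by multiples of the basis vectors `Xᵢ`. -/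
def lattice (b : Module.Basis ι K 𝔤) (e : ι → ℤ) : AddSubgroup 𝔤 where
  carrier := {X | ∀ i, b.repr X i ∈ fracIdeal K (e i)}
  zero_mem' i := by simp
  add_mem' {X Y} hX hY i := by simpa using add_mem (hX i) (hY i)
  neg_mem' {X} hX i := by simpa using hX i

variable {b : Module.Basis ι K 𝔤}

theorem mem_lattice {e : ι → ℤ} {X : 𝔤} :
    X ∈ lattice b e ↔ ∀ i, b.repr X i ∈ fracIdeal K (e i) := Iff.rfl

theorem lattice_anti {e e' : ι → ℤ} (h : e ≤ e') : lattice b e' ≤ lattice b e :=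
  fun _ hX i => fracIdeal_anti (h i) (hX i)

theorem smul_mem_lattice {m : ℤ} {e : ι → ℤ} {a : K} {X : 𝔤} (ha : a ∈ fracIdeal K m)
    (hX : X ∈ lattice b e) : a • X ∈ lattice b (fun i => m + e i) := fun i => by
  simpa using mul_mem_fracIdeal ha (hX i)

variable [Fintype ι]

/-- A finite family of scalars has a common denominator. -/
theorem exists_forall_mem_fracIdeal {κ : Type*} (s : Finset κ) (a : κ → K) :
    ∃ c : ℕ, ∀ k ∈ s, a k ∈ fracIdeal K (-c) := by
  choose n hn using fun k => exists_mem_fracIdeal (a k)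
  exact ⟨s.sup n, fun k hk => fracIdeal_anti
    (neg_le_neg (by exact_mod_cast Finset.le_sup hk)) (hn k)⟩

variable (b) in
/-- The structure constants of the basis have a common denominator. -/
theorem exists_lie_mem_lattice : ∃ c : ℕ, ∀ (m n : ℤ) (X Y : 𝔤), X ∈ lattice b (fun _ => m) →
    Y ∈ lattice b (fun _ => n) → ⁅X, Y⁆ ∈ lattice b (fun _ => m + n - c) := by
  obtain ⟨c, hc⟩ := exists_forall_mem_fracIdeal Finset.univ
    fun t : ι × ι × ι => b.repr ⁅b t.1, b t.2.1⁆ t.2.2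
  refine ⟨c, fun m n X Y hX hY => ?_⟩
  have h : ⁅X, Y⁆ = ∑ i, ∑ j, (b.repr X i * b.repr Y j) • ⁅b i, b j⁆ := by
    conv_lhs => rw [← b.sum_repr X, ← b.sum_repr Y]
    simp only [sum_lie_sum, smul_lie, lie_smul, smul_smul]
    simp only [mul_comm]
  rw [h]
  refine sum_mem fun i _ => sum_mem fun j _ => ?_
  exact smul_mem_lattice (mul_mem_fracIdeal (hX i) (hY j))
    (e := fun _ => -(c : ℤ)) fun k => hc (i, j, k) (Finset.mem_univ _)

/-- The index of a lattice in a larger one, computed one coordinate at a time. -/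
theorem relIndex_lattice [DecidableEq ι] (e : ι → ℤ) (k : ι → ℕ) :
    (lattice b (fun i => e i + k i)).relIndex (lattice b e) = residueCard K ^ ∑ i, k i := by
  suffices h : ∀ s : Finset ι, (lattice b (fun i => e i + if i ∈ s then (k i : ℤ) else 0)).relIndex
      (lattice b e) = residueCard K ^ ∑ i ∈ s, k i by
    simpa using h Finset.univ
  intro s
  induction s using Finset.induction_on with
  | empty => simp
  | insert j s hj ih =>
    set e₁ : ι → ℤ := fun i => e i + if i ∈ s then (k i : ℤ) else 0 with he₁
    set e₂ : ι → ℤ := fun i => e i + if i ∈ insert j s then (k i : ℤ) else 0 with he₂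
    have h0 : e ≤ e₁ := fun i => by simp only [he₁]; split_ifs <;> simp
    have h1 : e₁ ≤ e₂ := fun i => by
      simp only [he₁, he₂, Finset.mem_insert]; split_ifs <;> simp_all
    have hj₁ : e₁ j = e j := by simp [he₁, hj]
    have hj₂ : e₂ j = e j + k j := by simp [he₂]
    -- The two lattices differ in the coordinate `j` only.
    have hinf : lattice b e₂ = lattice b e₁ ⊓
        (fracIdeal K (e j + k j)).comap (b.coord j).toAddMonoidHom := by
      ext X
      constructor
      · exact fun hX => ⟨lattice_anti h1 hX, hj₂ ▸ hX j⟩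
      · rintro ⟨hX, hXj⟩ i
        rcases eq_or_ne i j with rfl | hij
        · rw [hj₂]; exact hXj
        · have : e₂ i = e₁ i := by simp [he₁, he₂, hij]
          rw [this]; exact hX i
    have hmap : (lattice b e₁).map (b.coord j).toAddMonoidHom = fracIdeal K (e j) := by
      ext x
      constructor
      · rintro ⟨X, hX, rfl⟩
        rw [← hj₁]; exact hX j
      · intro hx
        refine ⟨x • b j, fun i => ?_, by simp⟩
        rcases eq_or_ne i j with rfl | hij
        · simpa [hj₁] using hx
        · simp [hij.symm]
    rw [← AddSubgroup.relIndex_mul_relIndex _ _ _ (lattice_anti h1) (lattice_anti h0), ih, hinf,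
      AddSubgroup.inf_relIndex_left, AddSubgroup.relIndex_comap, hmap, relIndex_fracIdeal,
      Finset.sum_insert hj, pow_add]

/-! ### Topology of the Lie algebra -/

variable [TopologicalSpace 𝔤] [IsModuleTopology K 𝔤]

variable (b) in
/-- The coordinates with respect to a basis, as a homeomorphism onto `ι → K`. -/
noncomputable def coordHomeomorph : 𝔤 ≃ₜ (ι → K) where
  toEquiv := b.equivFun.toEquiv
  continuous_toFun := IsModuleTopology.continuous_of_linearMap b.equivFun.toLinearMap
  continuous_invFun := by
    have : ContinuousAdd 𝔤 := IsModuleTopology.toContinuousAdd K 𝔤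
    have : ContinuousSMul K 𝔤 := IsModuleTopology.toContinuousSMul K 𝔤
    exact IsModuleTopology.continuous_of_linearMap b.equivFun.symm.toLinearMap

theorem lattice_eq_preimage (e : ι → ℤ) :
    (lattice b e : Set 𝔤) =
      coordHomeomorph b ⁻¹' Set.univ.pi fun i => (fracIdeal K (e i) : Set K) := by
  ext X
  rw [SetLike.mem_coe, mem_lattice, Set.mem_preimage, Set.mem_univ_pi]
  rfl

theorem isOpen_lattice (e : ι → ℤ) : IsOpen (lattice b e : Set 𝔤) := by
  rw [lattice_eq_preimage]
  exact (isOpen_set_pi Set.finite_univ fun i _ => isOpen_fracIdeal _).preimage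
    (coordHomeomorph b).continuous

theorem isCompact_lattice (e : ι → ℤ) : IsCompact (lattice b e : Set 𝔤) := by
  rw [lattice_eq_preimage, (coordHomeomorph b).isCompact_preimage]
  exact isCompact_univ_pi fun i => isCompact_fracIdeal _

theorem secondCountableTopology_of_basis (b : Module.Basis ι K 𝔤) : SecondCountableTopology 𝔤 :=
  have := secondCountableTopology_localField K
  (coordHomeomorph b).secondCountableTopology

theorem t2Space_of_basis (b : Module.Basis ι K 𝔤) : T2Space 𝔤 :=
  have := t2Space_localField K
  (coordHomeomorph b).symm.t2Space

theorem locallyCompactSpace_of_basis (b : Module.Basis ι K 𝔤) : LocallyCompactSpace 𝔤 :=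
  (coordHomeomorph b).isClosedEmbedding.locallyCompactSpace

end Lattice

/-! ### The Baker-Campbell-Hausdorff product -/

section BCH

/-- The word in two letters, `true` for `X` and `false` for `Y`, underlying the monomial
`X ^ r₁ Y ^ s₁ ⋯ X ^ rₙ Y ^ sₙ`. -/
def monomialWord {m n : ℕ} (p : Fin n → Fin (m + 1) × Fin (m + 1)) : List Bool :=
  (List.ofFn p).flatMap fun a => List.replicate (a.1 : ℕ) true ++ List.replicate (a.2 : ℕ) false

theorem length_monomialWord {m n : ℕ} (p : Fin n → Fin (m + 1) × Fin (m + 1)) :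
    (monomialWord p).length = ∑ i, (((p i).1 : ℕ) + ((p i).2 : ℕ)) := by
  simp [monomialWord, List.length_flatMap, List.map_ofFn, List.sum_ofFn]

/-- The coefficient of a monomial in Dynkin's formula. -/
noncomputable def bchCoeff (K : Type*) [Field K] (m n : ℕ)
    (p : Fin n → Fin (m + 1) × Fin (m + 1)) : K :=
  ((-1 : K) ^ (n - 1) / (n : K)) *
    ((m : K) * ∏ i, (((p i).1 : ℕ).factorial : K) * (((p i).2 : ℕ).factorial : K))⁻¹

variable {K 𝔤 : Type*} [Field K] [LieRing 𝔤] [LieAlgebra K 𝔤]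

variable (K) in
theorem bchTerm_eq_sum_word (m : ℕ) (X Y : 𝔤) :
    bchTerm K m X Y = ∑ n ∈ Finset.Icc 1 m, ∑ p : Fin n → Fin (m + 1) × Fin (m + 1) with
        (∀ i, 0 < ((p i).1 : ℕ) + ((p i).2 : ℕ)) ∧
          ∑ i, (((p i).1 : ℕ) + ((p i).2 : ℕ)) = m,
      bchCoeff K m n p • nestedBracket ((monomialWord p).map fun t => if t then X else Y) := by
  simp [bchTerm, bchCoeff, monomialWord, Finset.smul_sum, smul_smul, List.map_flatMap]

variable (K) in
theorem bchTerm_one (X Y : 𝔤) : bchTerm K 1 X Y = X + Y := by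
  have h : (Finset.univ.filter fun p : Fin 1 → Fin 2 × Fin 2 =>
      (∀ i, 0 < ((p i).1 : ℕ) + ((p i).2 : ℕ)) ∧ ∑ i, (((p i).1 : ℕ) + ((p i).2 : ℕ)) = 1) =
      {fun _ => (1, 0), fun _ => (0, 1)} := by decide
  rw [bchTerm_eq_sum_word, Finset.Icc_self, Finset.sum_singleton, h, Finset.sum_pair (by decide)]
  simp [bchCoeff, monomialWord, nestedBracket]

variable (K) in
/-- If the nilpotency class is `0`, the sum defining `bch` is empty, but then `𝔤 = 0`. -/
theorem bch_eq_add_add_sum [LieRing.IsNilpotent 𝔤] (X Y : 𝔤) :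
    bch K X Y =
      X + Y + ∑ m ∈ Finset.Icc 2 (LieModule.nilpotencyLength 𝔤 𝔤), bchTerm K m X Y := by
  rcases Nat.eq_zero_or_pos (LieModule.nilpotencyLength 𝔤 𝔤) with h | h
  · have := (LieModule.nilpotencyLength_eq_zero_iff 𝔤 𝔤).1 h
    exact Subsingleton.elim _ _
  · rw [bch, ← Finset.insert_Icc_add_one_left_eq_Icc h, Finset.sum_insert (by simp), bchTerm_one]
    rfl

theorem map_nestedBracket {𝔥 : Type*} [LieRing 𝔥] (D : 𝔤 → 𝔥) (h0 : D 0 = 0)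
    (h : ∀ X Y, D ⁅X, Y⁆ = ⁅D X, D Y⁆) :
    ∀ l : List 𝔤, D (nestedBracket l) = nestedBracket (l.map D)
  | [] => h0
  | [x] => rfl
  | x :: y :: l => by
    have ih := map_nestedBracket D h0 h (y :: l)
    rw [List.map_cons] at ih
    simp only [nestedBracket, List.map_cons, h, ih]

theorem map_bch {D : 𝔤 →ₗ[K] 𝔤} (h : ∀ X Y, D ⁅X, Y⁆ = ⁅D X, D Y⁆) (X Y : 𝔤) :
    D (bch K X Y) = bch K (D X) (D Y) := by
  simp only [bch, bchTerm_eq_sum_word, map_sum, map_smul,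
    map_nestedBracket D (map_zero D) h, List.map_map]
  have h2 : (D ∘ fun t : Bool => if t then X else Y) = fun t => if t then D X else D Y := by
    funext t; cases t <;> rfl
  rw [h2]

theorem nestedBracket_of_forall_mem_span {x : 𝔤} :
    ∀ l : List 𝔤, (∀ y ∈ l, y ∈ K ∙ x) →
      nestedBracket l ∈ K ∙ x ∧ (2 ≤ l.length → nestedBracket l = 0)
  | [], _ => ⟨zero_mem _, fun h => by simp at h⟩
  | [y], h => ⟨h y (by simp), fun h => by simp at h⟩
  | y :: z :: l, h => by
    have ih := (nestedBracket_of_forall_mem_span (z :: l) fun w hw => h w (by simp [hw])).1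
    have h0 : nestedBracket (y :: z :: l) = 0 := by
      obtain ⟨a, ha⟩ := Submodule.mem_span_singleton.1 ih
      obtain ⟨c, hc⟩ := Submodule.mem_span_singleton.1 (h y (by simp))
      simp [nestedBracket, ← ha, ← hc]
    exact ⟨h0 ▸ zero_mem _, fun _ => h0⟩

/-- The product of two vectors on the same line is their sum, as all brackets vanish. -/
theorem bch_of_mem_span [LieRing.IsNilpotent 𝔤] {x X Y : 𝔤} (hX : X ∈ K ∙ x) (hY : Y ∈ K ∙ x) :
    bch K X Y = X + Y := by
  rw [bch_eq_add_add_sum, add_eq_left]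
  refine Finset.sum_eq_zero fun m hm => ?_
  rw [bchTerm_eq_sum_word]
  refine Finset.sum_eq_zero fun n _ => Finset.sum_eq_zero fun p hp => ?_
  rw [(nestedBracket_of_forall_mem_span (K := K) (x := x) _ ?_).2 ?_, smul_zero]
  · intro y hy
    obtain ⟨t, -, rfl⟩ := List.mem_map.1 hy
    cases t
    exacts [hY, hX]
  · rw [List.length_map, length_monomialWord, (Finset.mem_filter.1 hp).2.2]
    exact (Finset.mem_Icc.1 hm).1

end BCH

section Local

variable {K 𝔤 : Type*} [Field K] [ValuativeRel K] [TopologicalSpace K]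
  [IsNonarchimedeanLocalField K] [LieRing 𝔤] [LieAlgebra K 𝔤] {ι : Type*}
  {b : Module.Basis ι K 𝔤}

/-- Changing the entries of a nested bracket by elements of `∑ 𝔭 ^ j Xᵢ` changes its value by an
element of the same lattice, and of a smaller one as soon as a bracket is taken at all. -/
theorem nestedBracket_sub_mem_lattice {c : ℕ} (hc : ∀ (m n : ℤ) (X Y : 𝔤),
      X ∈ lattice b (fun _ => m) → Y ∈ lattice b (fun _ => n) →
        ⁅X, Y⁆ ∈ lattice b (fun _ => m + n - c))
    {N j : ℤ} (hN : c ≤ N) {f g : Bool → 𝔤}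
    (hf : ∀ t, f t ∈ lattice b (fun _ => N)) (hg : ∀ t, g t ∈ lattice b (fun _ => N))
    (hfg : ∀ t, f t - g t ∈ lattice b (fun _ => j)) :
    ∀ l : List Bool, nestedBracket (l.map f) ∈ lattice b (fun _ => N) ∧
      nestedBracket (l.map f) - nestedBracket (l.map g) ∈ lattice b (fun _ => j) ∧
      (2 ≤ l.length → nestedBracket (l.map f) - nestedBracket (l.map g) ∈
        lattice b (fun _ => j + N - c))
  | [] => ⟨zero_mem _, by simp, fun h => by simp at h⟩
  | [t] => ⟨hf t, hfg t, fun h => by simp at h⟩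
  | t :: u :: l => by
    obtain ⟨h1, h2, -⟩ := nestedBracket_sub_mem_lattice hc hN hf hg hfg (u :: l)
    have h3 : nestedBracket ((t :: u :: l).map f) - nestedBracket ((t :: u :: l).map g) ∈
        lattice b (fun _ => j + N - c) := by
      have h4 : nestedBracket ((t :: u :: l).map f) - nestedBracket ((t :: u :: l).map g) =
          ⁅f t - g t, nestedBracket ((u :: l).map f)⁆ +
          ⁅g t, nestedBracket ((u :: l).map f) - nestedBracket ((u :: l).map g)⁆ := by
        simp only [List.map_cons, nestedBracket, sub_lie, lie_sub]
        abel
      rw [h4]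
      refine add_mem (hc _ _ _ _ (hfg t) h1) ?_
      rw [add_comm j N]
      exact hc _ _ _ _ (hg t) h2
    exact ⟨lattice_anti (fun _ => by simp; omega) (hc _ _ _ _ (hf t) h1),
      lattice_anti (fun _ => by simp; omega) h3, fun _ => h3⟩

variable [LieRing.IsNilpotent 𝔤] [Fintype ι]

variable (b) in
/-- On a small lattice the Baker-Campbell-Hausdorff product is Lipschitz in its second argument:
the higher brackets gain more than the denominators of their coefficients lose. -/
theorem exists_bch_sub_bch_mem_lattice : ∃ N : ℤ, ∀ j : ℤ, N ≤ j → ∀ X Y Z : 𝔤,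
    X ∈ lattice b (fun _ => N) → Y ∈ lattice b (fun _ => N) → Z ∈ lattice b (fun _ => N) →
    Y - Z ∈ lattice b (fun _ => j) → bch K X Y - bch K X Z ∈ lattice b (fun _ => j) := by
  obtain ⟨c, hc⟩ := exists_lie_mem_lattice b
  obtain ⟨c', hc'⟩ := exists_forall_mem_fracIdeal
    ((Finset.Icc 2 (LieModule.nilpotencyLength 𝔤 𝔤)).sigma fun m =>
      (Finset.Icc 1 m).sigma fun n =>
        (Finset.univ : Finset (Fin n → Fin (m + 1) × Fin (m + 1))))
    fun k => bchCoeff K k.1 k.2.1 k.2.2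
  -- Each bracket with an entry from `𝔭 ^ (c + c')` gains `c'` powers of `𝔭`, and the coefficient
  -- loses at most `c'` of them.
  refine ⟨c + c', fun j hj X Y Z hX hY hZ hYZ => ?_⟩
  have hsum : bch K X Y - bch K X Z = (Y - Z) +
      ∑ m ∈ Finset.Icc 2 (LieModule.nilpotencyLength 𝔤 𝔤),
        (bchTerm K m X Y - bchTerm K m X Z) := by
    rw [bch_eq_add_add_sum, bch_eq_add_add_sum, Finset.sum_sub_distrib]
    abel
  rw [hsum]
  refine add_mem hYZ (sum_mem fun m hm => ?_)
  simp only [bchTerm_eq_sum_word, ← Finset.sum_sub_distrib, ← smul_sub]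
  refine sum_mem fun n hn => sum_mem fun p hp => ?_
  have hcoeff : bchCoeff K m n p ∈ fracIdeal K (-c') :=
    hc' ⟨m, n, p⟩ (by simp only [Finset.mem_sigma, Finset.mem_univ, hm, hn, and_self])
  have hlen : 2 ≤ (monomialWord p).length := by
    rw [length_monomialWord, (Finset.mem_filter.1 hp).2.2]
    exact (Finset.mem_Icc.1 hm).1
  have hdiff := (nestedBracket_sub_mem_lattice hc (N := c + c') (j := j) (by omega)
    (f := fun t => if t then X else Y) (g := fun t => if t then X else Z)
    (by intro t; cases t <;> simpa) (by intro t; cases t <;> simpa)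
    (by intro t; cases t <;> simp [hYZ]) (monomialWord p)).2.2 hlen
  exact lattice_anti (fun _ => by simp; omega) (smul_mem_lattice hcoeff hdiff)

end Local

/-! ### Inequalities for sums and integrals -/

theorem tsum_rpow_le_rpow_tsum {ι : Type*} (b : ι → ℝ≥0∞) {r s : ℝ} (hr : 0 < r) (hrs : r ≤ s) :
    ∑' n, b n ^ s ≤ (∑' n, b n ^ r) ^ (s / r) := by
  set B := ∑' n, b n ^ r with hB
  have h : ∀ n, b n ^ s ≤ b n ^ r * B ^ (s / r - 1) := fun n => by
    have h1 : b n ^ s = b n ^ r * (b n ^ r) ^ (s / r - 1) := by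
      rw [← ENNReal.rpow_mul, ← ENNReal.rpow_add_of_nonneg _ _ hr.le]
      · congr 1; field_simp; ring
      · have : 1 ≤ s / r := (one_le_div hr).2 hrs
        exact mul_nonneg hr.le (by linarith)
    rw [h1]
    have : 1 ≤ s / r := (one_le_div hr).2 hrs
    gcongr
    exact ENNReal.le_tsum (f := fun n => b n ^ r) n
  calc ∑' n, b n ^ s ≤ ∑' n, b n ^ r * B ^ (s / r - 1) := ENNReal.tsum_le_tsum h
    _ = B * B ^ (s / r - 1) := ENNReal.tsum_mul_right
    _ = B ^ (s / r) := by
      have : 1 ≤ s / r := (one_le_div hr).2 hrs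
      nth_rw 1 [← ENNReal.rpow_one B]
      rw [← ENNReal.rpow_add_of_nonneg _ _ zero_le_one (by linarith)]
      congr 1; ring

/-- Jensen's inequality for the weights `w`, which need not add up to one. -/
theorem rpow_tsum_mul_le {ι : Type*} (w b : ι → ℝ≥0∞) {s : ℝ} (hs : 1 < s) :
    (∑' j, w j * b j) ^ s ≤ (∑' j, w j) ^ (s - 1) * ∑' j, w j * b j ^ s := by
  let : MeasurableSpace ι := ⊤
  have hs0 : 0 < s := zero_lt_one.trans hs
  have hconj := (Real.HolderConjugate.conjExponent hs).symm
  set s' := s.conjExponent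
  have h := ENNReal.lintegral_mul_le_Lp_mul_Lq Measure.count hconj
    (f := fun j => w j ^ (1 / s')) (g := fun j => w j ^ (1 / s) * b j)
    (measurable_from_top.aemeasurable) (measurable_from_top.aemeasurable)
  have h1 : ∀ j, ((fun j => w j ^ (1 / s')) * fun j => w j ^ (1 / s) * b j) j = w j * b j := by
    intro j
    rw [Pi.mul_apply, ← mul_assoc, ← ENNReal.rpow_add_of_nonneg _ _
      (one_div_nonneg.2 hconj.nonneg) (one_div_nonneg.2 hs0.le)]
    rw [one_div, one_div, hconj.inv_add_inv_eq_one, ENNReal.rpow_one]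
  have h2 : ∀ j, (w j ^ (1 / s')) ^ s' = w j := fun j => by
    rw [← ENNReal.rpow_mul, one_div_mul_cancel hconj.ne_zero, ENNReal.rpow_one]
  have h3 : ∀ j, (w j ^ (1 / s) * b j) ^ s = w j * b j ^ s := fun j => by
    rw [ENNReal.mul_rpow_of_nonneg _ _ hs0.le, ← ENNReal.rpow_mul, one_div_mul_cancel hs0.ne',
      ENNReal.rpow_one]
  have hmeas : MeasurableSingletonClass ι := ⟨fun _ => trivial⟩
  simp only [lintegral_count, h1, h2, h3] at h
  calc (∑' j, w j * b j) ^ s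
      ≤ ((∑' j, w j) ^ (1 / s') * (∑' j, w j * b j ^ s) ^ (1 / s)) ^ s := by gcongr
    _ = (∑' j, w j) ^ (s - 1) * ∑' j, w j * b j ^ s := by
      rw [ENNReal.mul_rpow_of_nonneg _ _ hs0.le, ← ENNReal.rpow_mul, ← ENNReal.rpow_mul,
        one_div_mul_cancel hs0.ne', ENNReal.rpow_one]
      congr 2
      have := hconj.symm.sub_one_mul_conj
      have h0 := hconj.ne_zero
      field_simp
      linarith

/-- The discrete Hardy inequality: convolution with a geometric sequence maps `ℓ ^ r` to `ℓ ^ s`. -/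
theorem tsum_rpow_geometric_le (b : ℤ → ℝ≥0∞) (t : ℝ≥0∞) {r s : ℝ} (hr : 1 < r) (hrs : r ≤ s) :
    (∑' n : ℤ, (∑' j : ℕ, t ^ j * b (n + j)) ^ s) ^ (1 / s) ≤
      (∑' j : ℕ, t ^ j) * (∑' n, b n ^ r) ^ (1 / r) := by
  have hr0 : 0 < r := zero_lt_one.trans hr
  have hs : 1 < s := hr.trans_le hrs
  have hs0 : 0 < s := zero_lt_one.trans hs
  set T := ∑' j : ℕ, t ^ j
  have h : ∑' n : ℤ, (∑' j : ℕ, t ^ j * b (n + j)) ^ s ≤ T ^ s * (∑' n, b n ^ r) ^ (s / r) := by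
    calc ∑' n : ℤ, (∑' j : ℕ, t ^ j * b (n + j)) ^ s
        ≤ ∑' n : ℤ, T ^ (s - 1) * ∑' j : ℕ, t ^ j * b (n + j) ^ s :=
          ENNReal.tsum_le_tsum fun n => rpow_tsum_mul_le _ _ hs
      _ = T ^ (s - 1) * ∑' j : ℕ, ∑' n : ℤ, t ^ j * b (n + j) ^ s := by
          rw [ENNReal.tsum_mul_left, ENNReal.tsum_comm]
      _ = T ^ (s - 1) * (T * ∑' n, b n ^ s) := by
          simp only [ENNReal.tsum_mul_left]
          rw [← ENNReal.tsum_mul_right]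
          congr 2
          funext j
          congr 1
          exact (Equiv.addRight (j : ℤ)).tsum_eq fun n => b n ^ s
      _ = T ^ s * ∑' n, b n ^ s := by
          rw [← mul_assoc]
          congr 1
          nth_rw 2 [← ENNReal.rpow_one T]
          rw [← ENNReal.rpow_add_of_nonneg _ _ (by linarith) zero_le_one, sub_add_cancel]
      _ ≤ T ^ s * (∑' n, b n ^ r) ^ (s / r) := by
          gcongr
          exact tsum_rpow_le_rpow_tsum b hr0 hrs
  calc (∑' n : ℤ, (∑' j : ℕ, t ^ j * b (n + j)) ^ s) ^ (1 / s)
      ≤ (T ^ s * (∑' n, b n ^ r) ^ (s / r)) ^ (1 / s) := by gcongr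
    _ = T * (∑' n, b n ^ r) ^ (1 / r) := by
      rw [ENNReal.mul_rpow_of_nonneg _ _ (by positivity), ← ENNReal.rpow_mul, ← ENNReal.rpow_mul,
        mul_one_div_cancel hs0.ne', ENNReal.rpow_one]
      congr 2
      field_simp

/-- Hölder's inequality with respect to the weight `w`. -/
theorem lintegral_le_rpow_mul_rpow_weight {α : Type*} [MeasurableSpace α] {μ : Measure α}
    {f w : α → ℝ≥0∞} (hf : AEMeasurable f μ) (hw : AEMeasurable w μ) (hw_top : ∀ x, w x ≠ ∞)
    {r r' : ℝ} (hr : r.HolderConjugate r') (hfin : ∫⁻ x, w x ^ (1 - r') ∂μ ≠ ∞) :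
    ∫⁻ x, f x ∂μ ≤
      (∫⁻ x, f x ^ r * w x ∂μ) ^ (1 / r) * (∫⁻ x, w x ^ (1 - r') ∂μ) ^ (1 / r') := by
  have hr'1 : 1 < r' := hr.symm.lt
  -- Where `w` vanishes, `w ^ (1 - r') = ∞`.
  have hne : ∀ᵐ x ∂μ, w x ≠ 0 := by
    filter_upwards [ae_lt_top' (hw.pow_const _) hfin] with x hx h0
    rw [h0, ENNReal.zero_rpow_of_neg (by linarith)] at hx
    exact lt_irrefl _ hx
  have h1 : ∫⁻ x, f x ∂μ =
      ∫⁻ x, ((fun x => f x * w x ^ (1 / r)) * fun x => w x ^ (-(1 / r))) x ∂μ := by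
    refine lintegral_congr_ae (hne.mono fun x hx => ?_)
    simp only [Pi.mul_apply]
    rw [mul_assoc, ← ENNReal.rpow_add _ _ hx (hw_top x), add_neg_cancel, ENNReal.rpow_zero, mul_one]
  have h2 : ∀ x, (f * fun x => w x ^ (1 / r)) x ^ r = f x ^ r * w x := fun x => by
    rw [Pi.mul_apply, ENNReal.mul_rpow_of_nonneg _ _ hr.nonneg, ← ENNReal.rpow_mul,
      one_div_mul_cancel hr.ne_zero, ENNReal.rpow_one]
  have h3 : ∀ x, (w x ^ (-(1 / r))) ^ r' = w x ^ (1 - r') := fun x => by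
    rw [← ENNReal.rpow_mul]
    congr 1
    have := hr.symm.sub_one_mul_conj
    have h0 := hr.ne_zero
    field_simp
    linarith
  have h := ENNReal.lintegral_mul_le_Lp_mul_Lq μ hr (hf.mul (hw.pow_const (1 / r)))
    (hw.pow_const (-(1 / r)))
  simp only [h2, h3] at h
  rw [h1]
  exact h

/-! ### Dilations and the homogeneous dimension -/

section Grading

variable {K 𝔤 : Type*} [Field K] [LieRing 𝔤] [LieAlgebra K 𝔤] (V : ℕ → Submodule K 𝔤)
  [GradedLieAlgebra V]

theorem lieDilation_of_mem (γ : K) {k : ℕ} {X : 𝔤} (hX : X ∈ V k) :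
    lieDilation V γ X = γ ^ k • X := by
  have h : DirectSum.decomposeLinearEquiv V X = DirectSum.lof K ℕ (fun k => V k) k ⟨X, hX⟩ :=
    DirectSum.decompose_of_mem V hX
  rw [lieDilation, LinearMap.comp_apply, LinearEquiv.coe_coe, h, DirectSum.toModule_lof]
  rfl

theorem lieDilation_lie (γ : K) (X Y : 𝔤) :
    lieDilation V γ ⁅X, Y⁆ = ⁅lieDilation V γ X, lieDilation V γ Y⁆ := by
  induction X using DirectSum.Decomposition.inductionOn V with
  | zero => simp
  | add X X' h h' => simp [h, h']
  | @homogeneous i X =>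
    induction Y using DirectSum.Decomposition.inductionOn V with
    | zero => simp
    | add Y Y' h h' => simp [h, h']
    | @homogeneous j Y =>
      rw [lieDilation_of_mem V γ X.2, lieDilation_of_mem V γ Y.2,
        lieDilation_of_mem V γ (SetLike.GradedBracket.bracket_mem X.2 Y.2)]
      rw [smul_lie, lie_smul, smul_smul, pow_add]

variable {V} {d : ℕ} {b : Module.Basis (Fin d) K 𝔤} {ν : Fin d → ℕ}

theorem repr_lieDilation (hb : ∀ i, b i ∈ V (ν i)) (γ : K) (X : 𝔤) (i : Fin d) :
    b.repr (lieDilation V γ X) i = γ ^ ν i * b.repr X i := by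
  conv_lhs => rw [← b.sum_repr X]
  simp only [map_sum, map_smul, lieDilation_of_mem V γ (hb _), b.repr_self]
  simp [Finsupp.single_apply, mul_comm]

/-- A basis of homogeneous vectors contains a basis of each homogeneous component. -/
theorem finrank_eq_card_weight (hb : ∀ i, b i ∈ V (ν i)) (k : ℕ) :
    Module.finrank K (V k) = (Finset.univ.filter fun i => ν i = k).card := by
  have hspan : V k = Submodule.span K (Set.range fun i : {i // ν i = k} => b i) := by
    apply le_antisymm
    · intro X hX
      have h : X = ∑ i, b.repr X i • ((DirectSum.decompose V (b i) k : V k) : 𝔤) := by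
        let P : 𝔤 →ₗ[K] 𝔤 := (V k).subtype ∘ₗ DirectSum.component K ℕ (fun k => V k) k ∘ₗ
          (DirectSum.decomposeLinearEquiv V).toLinearMap
        have hP : P X = ∑ i, b.repr X i • P (b i) := by
          conv_lhs => rw [← b.sum_repr X]
          simp only [map_sum, map_smul]
        rw [← show P X = X from DirectSum.decompose_of_mem_same V hX]
        conv_rhs => rw [show P X = X from DirectSum.decompose_of_mem_same V hX]
        exact hP
      rw [h]
      refine Submodule.sum_mem _ fun i _ => Submodule.smul_mem _ _ ?_
      by_cases hi : ν i = k
      · rw [← hi, DirectSum.decompose_of_mem_same V (hb i), hi]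
        exact Submodule.subset_span ⟨⟨i, hi⟩, rfl⟩
      · rw [DirectSum.decompose_of_mem_ne V (hb i) hi]
        exact zero_mem _
    · rw [Submodule.span_le]
      rintro _ ⟨⟨i, rfl⟩, rfl⟩
      exact hb i
  rw [hspan, ← Function.comp_def b,
    finrank_span_eq_card (b.linearIndependent.comp _ Subtype.val_injective),
    Fintype.card_subtype]

theorem homogeneousDim_eq_sum (hb : ∀ i, b i ∈ V (ν i)) : homogeneousDim V = ∑ i, ν i := by
  rw [homogeneousDim, finsum_eq_sum_of_support_subset (s := Finset.univ.image ν)]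
  · rw [← Finset.sum_fiberwise_of_maps_to
      (fun i _ => Finset.mem_image_of_mem ν (Finset.mem_univ i))]
    refine Finset.sum_congr rfl fun k _ => ?_
    rw [finrank_eq_card_weight hb, Finset.sum_congr rfl fun i hi => (Finset.mem_filter.1 hi).2]
    simp [mul_comm]
  · intro k hk
    rw [Function.mem_support, finrank_eq_card_weight hb] at hk
    obtain ⟨i, hi⟩ := Finset.card_pos.1 (Nat.pos_of_ne_zero (right_ne_zero_of_mul hk))
    simp only [Finset.coe_image, Finset.coe_univ, Set.image_univ, Set.mem_range]
    exact ⟨i, (Finset.mem_filter.1 hi).2⟩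

end Grading

namespace GradedLieGroup

variable {K 𝔤 G : Type*} [Field K] [ValuativeRel K] [TopologicalSpace K]
  [IsNonarchimedeanLocalField K] [LieRing 𝔤] [LieAlgebra K 𝔤] [LieRing.IsNilpotent 𝔤]
  [TopologicalSpace 𝔤] [IsModuleTopology K 𝔤] [Group G] [TopologicalSpace G]
  [IsTopologicalGroup G] {V : ℕ → Submodule K 𝔤} [GradedLieAlgebra V] {d : ℕ}
  (𝒢 : GradedLieGroup K 𝔤 G V d)

/-! ### Exponential coordinates and small lattices -/

theorem homogeneousDim_eq_sum_weight : homogeneousDim V = ∑ i, 𝒢.weight i :=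
  homogeneousDim_eq_sum 𝒢.basis_mem

theorem weight_pos (i : Fin d) : 0 < 𝒢.weight i := by
  refine Nat.pos_of_ne_zero fun h => 𝒢.basis.ne_zero i ?_
  have := 𝒢.basis_mem i
  rwa [h, 𝒢.V_zero, Submodule.mem_bot] at this

theorem secondCountableTopology (𝒢 : GradedLieGroup K 𝔤 G V d) : SecondCountableTopology G :=
  have := secondCountableTopology_of_basis 𝒢.basis
  𝒢.exp.symm.secondCountableTopology

theorem t2Space (𝒢 : GradedLieGroup K 𝔤 G V d) : T2Space G :=
  have := t2Space_of_basis 𝒢.basis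
  𝒢.exp.t2Space

theorem locallyCompactSpace (𝒢 : GradedLieGroup K 𝔤 G V d) : LocallyCompactSpace G :=
  have := locallyCompactSpace_of_basis 𝒢.basis
  𝒢.exp.symm.isClosedEmbedding.locallyCompactSpace

theorem exp_zero : 𝒢.exp 0 = 1 := by
  have h := 𝒢.exp_bch 0 0
  rw [bch_of_mem_span (x := (0 : 𝔤)) (zero_mem _) (zero_mem _), add_zero] at h
  exact left_eq_mul.1 h

theorem exp_neg_mul_exp (X : 𝔤) : 𝒢.exp (-X) * 𝒢.exp X = 1 := by
  rw [← 𝒢.exp_bch, bch_of_mem_span (x := X) (neg_mem (Submodule.mem_span_singleton_self X))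
    (Submodule.mem_span_singleton_self X), neg_add_cancel, exp_zero]

theorem bch_zero (𝒢 : GradedLieGroup K 𝔤 G V d) (X : 𝔤) : bch K X 0 = X :=
  𝒢.exp.injective (by rw [𝒢.exp_bch, exp_zero, mul_one])

theorem bch_neg_self (𝒢 : GradedLieGroup K 𝔤 G V d) (X : 𝔤) : bch K (-X) X = 0 :=
  𝒢.exp.injective (by rw [𝒢.exp_bch, exp_neg_mul_exp, exp_zero])

/-- Close to the identity, left translations of the group carry small lattices to additive
translates of these lattices. -/
theorem exists_exp_add_lattice : ∃ N : ℤ, ∀ j : ℤ, N ≤ j → ∀ X ∈ lattice 𝒢.basis (fun _ => N),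
    ∀ Y : 𝔤, (𝒢.exp.symm ((𝒢.exp X)⁻¹ * 𝒢.exp Y) ∈ lattice 𝒢.basis (fun _ => j) ↔
      Y - X ∈ lattice 𝒢.basis (fun _ => j)) := by
  obtain ⟨N, hN⟩ := exists_bch_sub_bch_mem_lattice 𝒢.basis
  refine ⟨N, fun j hj X hX Y => ?_⟩
  have hle := lattice_anti (b := 𝒢.basis) (fun _ => hj : (fun _ => N) ≤ fun _ => j)
  have hinv : (𝒢.exp X)⁻¹ = 𝒢.exp (-X) := (eq_inv_of_mul_eq_one_left (𝒢.exp_neg_mul_exp X)).symm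
  constructor
  · intro h
    set Z := 𝒢.exp.symm ((𝒢.exp X)⁻¹ * 𝒢.exp Y) with hZ
    have hY : Y = bch K X Z := 𝒢.exp.injective (by rw [𝒢.exp_bch, hZ]; simp)
    have := hN j hj X Z 0 hX (hle h) (zero_mem _) (by simpa using h)
    rwa [𝒢.bch_zero, ← hY] at this
  · intro h
    have hY : Y ∈ lattice 𝒢.basis (fun _ => N) := by simpa using add_mem (hle h) hX
    have := hN j hj (-X) Y X (neg_mem hX) hY hX h
    rw [𝒢.bch_neg_self, sub_zero] at this
    rwa [hinv, ← 𝒢.exp_bch, Homeomorph.symm_apply_apply]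

variable [MeasurableSpace G] [BorelSpace G]

theorem measurableSet_exp_image_lattice (e : Fin d → ℤ) :
    MeasurableSet (𝒢.exp '' (lattice 𝒢.basis e : Set 𝔤)) :=
  (𝒢.exp.isOpenMap _ (isOpen_lattice e)).measurableSet

/-- A small lattice `L` is a union of additive cosets of a smaller one, and these all have the
same Haar measure. -/
theorem exists_measure_exp_image_eq_relIndex_mul (μ : Measure G) [μ.IsMulLeftInvariant] :
    ∃ N : ℤ, ∀ j : ℤ, N ≤ j → ∀ L : AddSubgroup 𝔤, lattice 𝒢.basis (fun _ => j) ≤ L →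
      L ≤ lattice 𝒢.basis (fun _ => N) → (lattice 𝒢.basis (fun _ => j)).relIndex L ≠ 0 →
      μ (𝒢.exp '' (L : Set 𝔤)) = (lattice 𝒢.basis (fun _ => j)).relIndex L *
        μ (𝒢.exp '' (lattice 𝒢.basis (fun _ => j) : Set 𝔤)) := by
  obtain ⟨N, hN⟩ := 𝒢.exists_exp_add_lattice
  refine ⟨N, fun j hj L hjL hLN hind => ?_⟩
  set M := lattice 𝒢.basis (fun _ => j)
  set H := M.addSubgroupOf L with hH
  have hfin : Finite (L ⧸ H) := @AddSubgroup.finite_quotient_of_finiteIndex _ _ H ⟨hind⟩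
  -- The image under `exp` of the coset `a` of `M` in `L`.
  set S : L ⧸ H → Set G := fun a => (fun y => (𝒢.exp (a.out : L))⁻¹ * y) ⁻¹' (𝒢.exp '' M)
  have hmem : ∀ (a : L ⧸ H) (Y : 𝔤), 𝒢.exp Y ∈ S a ↔ Y - (a.out : L) ∈ M := fun a Y => by
    rw [← hN j hj _ (hLN a.out.2) Y]
    constructor
    · rintro ⟨Z, hZ, hZ'⟩
      have hZ'' : 𝒢.exp Z = (𝒢.exp (a.out : L))⁻¹ * 𝒢.exp Y := hZ'
      rw [← hZ'', Homeomorph.symm_apply_apply]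
      exact hZ
    · exact fun h => ⟨_, h, Homeomorph.apply_symm_apply _ _⟩
  have hmk : ∀ (a : L ⧸ H) (Y : L), (Y : 𝔤) - (a.out : L) ∈ M ↔ (Y : L ⧸ H) = a := fun a Y => by
    conv_rhs => rw [← QuotientAddGroup.out_eq' a, eq_comm, QuotientAddGroup.eq]
    have h : ((-a.out + Y : L) : 𝔤) = (Y : 𝔤) - (a.out : L) := by simp [sub_eq_add_neg, add_comm]
    rw [← h]
    exact AddSubgroup.mem_addSubgroupOf.symm
  have hunion : 𝒢.exp '' (L : Set 𝔤) = ⋃ a, S a := by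
    ext y
    obtain ⟨Y, rfl⟩ := 𝒢.exp.surjective y
    rw [Set.mem_iUnion, 𝒢.exp.injective.mem_set_image]
    constructor
    · exact fun hY => ⟨((⟨Y, hY⟩ : L) : L ⧸ H), (hmem _ _).2 ((hmk _ ⟨Y, hY⟩).2 rfl)⟩
    · rintro ⟨a, ha⟩
      simpa using add_mem (hjL ((hmem a Y).1 ha)) a.out.2
  have hdisj : Pairwise (Function.onFun Disjoint S) := by
    intro a a' haa'
    refine Set.disjoint_left.2 fun y hy hy' => haa' ?_
    obtain ⟨Y, rfl⟩ := 𝒢.exp.surjective y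
    rw [hmem] at hy hy'
    have hYL : Y ∈ L := by simpa using add_mem (hjL hy) a.out.2
    rw [← (hmk a ⟨Y, hYL⟩).1 hy, ← (hmk a' ⟨Y, hYL⟩).1 hy']
  have hmeas : ∀ a, MeasurableSet (S a) := fun a =>
    measurable_const_mul _ (𝒢.measurableSet_exp_image_lattice _)
  rw [hunion, measure_iUnion hdisj hmeas]
  simp only [S, measure_preimage_mul, ENNReal.tsum_const]
  rw [AddSubgroup.relIndex, AddSubgroup.index, ENat.card_eq_coe_natCard]
  simp [hH]

end GradedLieGroup

namespace GradedLieGroup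

variable {K 𝔤 G : Type*} [Field K] [ValuativeRel K] [TopologicalSpace K]
  [IsNonarchimedeanLocalField K] [LieRing 𝔤] [LieAlgebra K 𝔤] [LieRing.IsNilpotent 𝔤]
  [TopologicalSpace 𝔤] [IsModuleTopology K 𝔤] [Group G] [TopologicalSpace G]
  [IsTopologicalGroup G] {V : ℕ → Submodule K 𝔤} [GradedLieAlgebra V] {d : ℕ}
  (𝒢 : GradedLieGroup K 𝔤 G V d)

/-! ### Dilations of the group and the filtration -/

theorem repr_exp_symm_dilation (γ : K) (x : G) (i : Fin d) :
    𝒢.basis.repr (𝒢.exp.symm (𝒢.dilation γ x)) i =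
      γ ^ 𝒢.weight i * 𝒢.basis.repr (𝒢.exp.symm x) i := by
  rw [dilation, Homeomorph.symm_apply_apply, repr_lieDilation 𝒢.basis_mem]

theorem ext_repr {x y : G}
    (h : ∀ i, 𝒢.basis.repr (𝒢.exp.symm x) i = 𝒢.basis.repr (𝒢.exp.symm y) i) : x = y :=
  𝒢.exp.symm.injective (𝒢.basis.repr.injective (Finsupp.ext h))

theorem dilation_dilation (γ γ' : K) (x : G) :
    𝒢.dilation γ (𝒢.dilation γ' x) = 𝒢.dilation (γ * γ') x :=
  𝒢.ext_repr fun i => by simp only [repr_exp_symm_dilation, mul_pow, mul_assoc]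

theorem dilation_one (x : G) : 𝒢.dilation 1 x = x :=
  𝒢.ext_repr fun i => by simp only [repr_exp_symm_dilation, one_pow, one_mul]

theorem dilation_mul (γ : K) (x y : G) :
    𝒢.dilation γ (x * y) = 𝒢.dilation γ x * 𝒢.dilation γ y := by
  have h : x * y = 𝒢.exp (bch K (𝒢.exp.symm x) (𝒢.exp.symm y)) := by simp [𝒢.exp_bch]
  rw [h, dilation, Homeomorph.symm_apply_apply, map_bch (lieDilation_lie V γ), 𝒢.exp_bch]
  rfl

theorem continuous_dilation (γ : K) : Continuous (𝒢.dilation γ) := by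
  have : ContinuousAdd 𝔤 := IsModuleTopology.toContinuousAdd K 𝔤
  have : ContinuousSMul K 𝔤 := IsModuleTopology.toContinuousSMul K 𝔤
  exact 𝒢.exp.continuous.comp
    ((IsModuleTopology.continuous_of_linearMap (lieDilation V γ)).comp 𝒢.exp.symm.continuous)

/-- The dilation by the `n`-th power of the uniformiser, an automorphism of the topological group
that carries `G_m` onto `G_{m + n}`. -/
noncomputable def shift (n : ℤ) : G ≃ₜ* G where
  toFun := 𝒢.dilation (uniformizer K ^ n)
  invFun := 𝒢.dilation (uniformizer K ^ (-n))
  left_inv x := by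
    rw [dilation_dilation, ← zpow_add₀ uniformizer_ne_zero, neg_add_cancel, zpow_zero, dilation_one]
  right_inv x := by
    rw [dilation_dilation, ← zpow_add₀ uniformizer_ne_zero, add_neg_cancel, zpow_zero, dilation_one]
  map_mul' := 𝒢.dilation_mul _
  continuous_toFun := 𝒢.continuous_dilation _
  continuous_invFun := 𝒢.continuous_dilation _

theorem shift_apply (n : ℤ) (x : G) : 𝒢.shift n x = 𝒢.dilation (uniformizer K ^ n) x := rfl

theorem shift_shift (m n : ℤ) (x : G) : 𝒢.shift m (𝒢.shift n x) = 𝒢.shift (m + n) x := by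
  rw [shift_apply, shift_apply, dilation_dilation, ← zpow_add₀ uniformizer_ne_zero, shift_apply]

theorem shift_zero (x : G) : 𝒢.shift 0 x = x := by
  rw [shift_apply, zpow_zero, dilation_one]

theorem exp_image_lattice_eq_preimage (e : Fin d → ℤ) :
    𝒢.exp '' (lattice 𝒢.basis e : Set 𝔤) = 𝒢.exp.symm ⁻¹' (lattice 𝒢.basis e : Set 𝔤) :=
  𝒢.exp.toEquiv.image_eq_preimage_symm _

theorem filtration_eq (n : ℤ) :
    𝒢.filtration n = 𝒢.exp '' (lattice 𝒢.basis (fun i => n * 𝒢.weight i) : Set 𝔤) := by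
  rw [exp_image_lattice_eq_preimage]
  rfl

theorem shift_preimage_exp_image_lattice (n : ℤ) (e : Fin d → ℤ) :
    𝒢.shift n ⁻¹' (𝒢.exp '' (lattice 𝒢.basis (fun i => n * 𝒢.weight i + e i) : Set 𝔤)) =
      𝒢.exp '' (lattice 𝒢.basis e : Set 𝔤) := by
  rw [exp_image_lattice_eq_preimage, exp_image_lattice_eq_preimage]
  ext x
  refine forall_congr' fun i => ?_
  rw [shift_apply, repr_exp_symm_dilation, ← zpow_natCast, ← zpow_mul,
    uniformizer_zpow_mul_mem_fracIdeal]

theorem shift_mem_filtration_iff {m n : ℤ} {x : G} :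
    𝒢.shift n x ∈ 𝒢.filtration (n + m) ↔ x ∈ 𝒢.filtration m := by
  rw [filtration_eq, filtration_eq,
    ← shift_preimage_exp_image_lattice 𝒢 n (fun i => m * 𝒢.weight i)]
  simp only [Set.mem_preimage, add_mul]

theorem filtration_anti {m n : ℤ} (h : m ≤ n) : 𝒢.filtration n ⊆ 𝒢.filtration m := by
  rw [filtration_eq, filtration_eq]
  exact Set.image_mono (lattice_anti fun i => mul_le_mul_of_nonneg_right h (Int.natCast_nonneg _))

theorem one_mem_filtration (n : ℤ) : (1 : G) ∈ 𝒢.filtration n := by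
  rw [filtration_eq, ← 𝒢.exp_zero]
  exact Set.mem_image_of_mem _ (zero_mem _)

theorem isOpen_filtration (n : ℤ) : IsOpen (𝒢.filtration n) := by
  rw [filtration_eq]
  exact 𝒢.exp.isOpenMap _ (isOpen_lattice _)

theorem isCompact_filtration (n : ℤ) : IsCompact (𝒢.filtration n) := by
  rw [filtration_eq]
  exact (isCompact_lattice _).image 𝒢.exp.continuous

/-- The shell `G_n \ G_{n+1}`. -/
def shell (n : ℤ) : Set G := 𝒢.filtration n \ 𝒢.filtration (n + 1)

theorem isCompact_shell (n : ℤ) : IsCompact (𝒢.shell n) :=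
  (𝒢.isCompact_filtration n).diff (𝒢.isOpen_filtration _)

theorem shift_preimage_shell (n : ℤ) : 𝒢.shift n ⁻¹' 𝒢.shell n = 𝒢.shell 0 := by
  ext x
  have h0 := 𝒢.shift_mem_filtration_iff (m := 0) (n := n) (x := x)
  have h1 := 𝒢.shift_mem_filtration_iff (m := 1) (n := n) (x := x)
  rw [add_zero] at h0
  simp only [shell, Set.mem_preimage, Set.mem_sdiff, h0, h1, zero_add]

theorem ne_one_of_mem_shell {n : ℤ} {x : G} (hx : x ∈ 𝒢.shell n) : x ≠ 1 := by
  rintro rfl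
  exact hx.2 (𝒢.one_mem_filtration _)

theorem isOpen_shell (n : ℤ) : IsOpen (𝒢.shell n) :=
  have := 𝒢.t2Space
  (𝒢.isOpen_filtration n).sdiff (𝒢.isCompact_filtration _).isClosed

theorem subset_sdiff_one_of_subset_shell {S T : Set G} {n : ℤ} (hT : T ⊆ 𝒢.shell n) (hTS : T ⊆ S) :
    T ⊆ S \ {1} :=
  fun _ hx => ⟨hTS hx, 𝒢.ne_one_of_mem_shell (hT hx)⟩

theorem exists_mem_filtration (x : G) : ∃ n : ℤ, x ∈ 𝒢.filtration n := by
  obtain ⟨c, hc⟩ := exists_forall_mem_fracIdeal Finset.univ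
    fun i => 𝒢.basis.repr (𝒢.exp.symm x) i
  refine ⟨-c, fun i => fracIdeal_anti ?_ (hc i (Finset.mem_univ i))⟩
  have : (1 : ℤ) ≤ 𝒢.weight i := by exact_mod_cast 𝒢.weight_pos i
  nlinarith [Int.natCast_nonneg c]

/-- As all weights are positive, the filtration shrinks to the identity. -/
theorem exists_notMem_filtration {x : G} (hx : x ≠ 1) : ∃ n : ℤ, x ∉ 𝒢.filtration n := by
  have h : ∃ i, 𝒢.basis.repr (𝒢.exp.symm x) i ≠ 0 := by
    by_contra! h
    refine hx (𝒢.ext_repr fun i => ?_)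
    rw [h i, ← 𝒢.exp_zero, Homeomorph.symm_apply_apply, map_zero]
    rfl
  obtain ⟨i, hi⟩ := h
  obtain ⟨k, hk⟩ := exists_absK_eq_zpow hi
  refine ⟨max 0 (-k) + 1, fun hn => ?_⟩
  have h1 := hn i
  rw [hk, zpow_le_zpow_iff_right₀ (one_lt_residueCard K)] at h1
  have h2 : (1 : ℤ) ≤ 𝒢.weight i := by exact_mod_cast 𝒢.weight_pos i
  have h3 := le_max_left 0 (-k)
  have h4 := le_max_right 0 (-k)
  nlinarith

theorem exists_mem_shell {x : G} (hx : x ≠ 1) : ∃ n : ℤ, x ∈ 𝒢.shell n := by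
  obtain ⟨N, hN⟩ := 𝒢.exists_notMem_filtration hx
  obtain ⟨n, hn, hmax⟩ := Int.exists_greatest_of_bdd (P := fun n => x ∈ 𝒢.filtration n)
    ⟨N, fun z hz => le_of_not_gt fun h => hN (𝒢.filtration_anti h.le hz)⟩
    (𝒢.exists_mem_filtration x)
  exact ⟨n, hn, fun h => by have := hmax _ h; omega⟩

theorem mem_filtration_iff_le {m n : ℤ} {x : G} (hx : x ∈ 𝒢.shell n) :
    x ∈ 𝒢.filtration m ↔ m ≤ n :=
  ⟨fun h => le_of_not_gt fun hlt => hx.2 (𝒢.filtration_anti hlt h),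
    fun h => 𝒢.filtration_anti h hx.1⟩

theorem pairwise_disjoint_shell : Pairwise (Function.onFun Disjoint 𝒢.shell) := by
  intro m n hmn
  refine Set.disjoint_left.2 fun x hm hn => hmn (le_antisymm ?_ ?_)
  · exact (𝒢.mem_filtration_iff_le hn).1 hm.1
  · exact (𝒢.mem_filtration_iff_le hm).1 hn.1

theorem homogeneousDim_pos (𝒢 : GradedLieGroup K 𝔤 G V d) {x : G} (hx : x ≠ 1) :
    0 < homogeneousDim V := by
  have h : Nonempty (Fin d) := by
    by_contra h
    rw [not_nonempty_iff] at h
    exact hx (𝒢.ext_repr fun i => h.elim i)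
  rw [𝒢.homogeneousDim_eq_sum_weight]
  exact Finset.sum_pos (fun i _ => 𝒢.weight_pos i) Finset.univ_nonempty

/-! ### The Haar measure of the filtration and the balls of the quasi-norm -/

variable [MeasurableSpace G]

theorem qnorm_one (μ : Measure G) : 𝒢.qnorm μ 1 = 0 := by
  rw [qnorm, dif_neg]
  rintro ⟨n, hn⟩
  exact hn.2 (𝒢.one_mem_filtration _)

variable [BorelSpace G]

theorem measurableSet_filtration (n : ℤ) : MeasurableSet (𝒢.filtration n) :=
  (𝒢.isOpen_filtration n).measurableSet

theorem measurableSet_shell (n : ℤ) : MeasurableSet (𝒢.shell n) :=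
  (𝒢.measurableSet_filtration n).diff (𝒢.measurableSet_filtration _)

theorem measurable_shift (n : ℤ) : Measurable (𝒢.shift n) :=
  (𝒢.shift n).toHomeomorph.continuous.measurable

/-- The dilation by the `n`-th power of the uniformiser, `n ≥ 0`, has the module `q ^ (-n Q)`: it
maps a small lattice onto a sublattice of index `q ^ (n Q)`. -/
theorem map_shift_natCast (μ : Measure G) [μ.IsHaarMeasure] (n : ℕ) :
    μ.map (𝒢.shift n) = ((residueCard K : ℝ≥0∞) ^ (n * homogeneousDim V)) • μ := by
  have := 𝒢.secondCountableTopology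
  have := 𝒢.t2Space
  have := 𝒢.locallyCompactSpace
  obtain ⟨N, hN⟩ := 𝒢.exists_measure_exp_image_eq_relIndex_mul μ
  set A := lattice 𝒢.basis (fun _ => N) with hA
  set A' := lattice 𝒢.basis (fun i => N + (n * 𝒢.weight i : ℕ)) with hA'
  set k : ℕ := Finset.univ.sup fun i => n * 𝒢.weight i with hk
  set B := lattice 𝒢.basis (fun _ => N + k) with hB
  have hq : residueCard K ≠ 0 := by
    have := residueCard_pos K
    exact_mod_cast this.ne'
  have hBA' : B ≤ A' := lattice_anti fun i => by
    have : n * 𝒢.weight i ≤ k := Finset.le_sup (f := fun i => n * 𝒢.weight i) (Finset.mem_univ i)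
    dsimp only
    omega
  have hA'A : A' ≤ A := lattice_anti fun i => by dsimp only; omega
  have hindex : A'.relIndex A = residueCard K ^ (n * homogeneousDim V) := by
    rw [hA', hA, relIndex_lattice, 𝒢.homogeneousDim_eq_sum_weight, Finset.mul_sum]
  have hindexB : B.relIndex A ≠ 0 := by
    rw [hB, hA, relIndex_lattice (fun _ => N) (fun _ => k)]
    exact pow_ne_zero _ hq
  have hmul := AddSubgroup.relIndex_mul_relIndex B A' A hBA' hA'A
  have hindexB' : B.relIndex A' ≠ 0 := left_ne_zero_of_mul (hmul ▸ hindexB)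
  have h1 := hN (N + k) (by omega) A (hBA'.trans hA'A) le_rfl hindexB
  have h2 := hN (N + k) (by omega) A' hBA' hA'A hindexB'
  have h3 : μ (𝒢.exp '' (A : Set 𝔤)) =
      (residueCard K : ℝ≥0∞) ^ (n * homogeneousDim V) * μ (𝒢.exp '' (A' : Set 𝔤)) := by
    rw [h1, h2, ← mul_assoc, ← hmul, hindex, mul_comm (B.relIndex A')]
    push_cast
    rfl
  have h4 : 𝒢.shift n ⁻¹' (𝒢.exp '' (A' : Set 𝔤)) = 𝒢.exp '' (A : Set 𝔤) := by
    rw [hA, hA', ← 𝒢.shift_preimage_exp_image_lattice n (fun _ => N)]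
    simp only [Nat.cast_mul, add_comm]
  -- By uniqueness of the Haar measure the module is a constant; the lattice `A'` determines it.
  have h5 := mulEquivHaarChar_smul_map μ (𝒢.shift n)
  set c := mulEquivHaarChar (𝒢.shift n) with hc
  have h6 := congrArg (fun ν : Measure G => ν (𝒢.exp '' (A' : Set 𝔤))) h5
  simp only [Measure.smul_apply, Measure.map_apply (𝒢.measurable_shift n)
    (𝒢.measurableSet_exp_image_lattice _), hA', ENNReal.smul_def, smul_eq_mul] at h6
  rw [← hA', h4, h3, ← mul_assoc] at h6
  have hpos : μ (𝒢.exp '' (A' : Set 𝔤)) ≠ 0 :=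
    ((𝒢.exp.isOpenMap _ (isOpen_lattice _)).measure_pos μ ⟨_, Set.mem_image_of_mem _
      (zero_mem A')⟩).ne'
  have htop : μ (𝒢.exp '' (A' : Set 𝔤)) ≠ ∞ :=
    ((isCompact_lattice _).image 𝒢.exp.continuous).measure_ne_top
  have h7 : (c : ℝ≥0∞) * (residueCard K : ℝ≥0∞) ^ (n * homogeneousDim V) = 1 := by
    rw [← ENNReal.mul_left_inj hpos htop, one_mul]
    exact h6
  ext s hs
  have h8 := congrArg (fun ν : Measure G => ν s) h5
  simp only [Measure.smul_apply, ENNReal.smul_def, smul_eq_mul] at h8 ⊢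
  rw [← h8, ← mul_assoc, mul_comm _ (c : ℝ≥0∞), h7, one_mul]

theorem map_shift (μ : Measure G) [μ.IsHaarMeasure] (n : ℤ) :
    μ.map (𝒢.shift n) = (residueCard K : ℝ≥0∞) ^ ((n : ℝ) * homogeneousDim V) • μ := by
  have hnat : ∀ m : ℕ, (residueCard K : ℝ≥0∞) ^ ((m : ℝ) * homogeneousDim V) =
      (residueCard K : ℝ≥0∞) ^ (m * homogeneousDim V) := fun m => by
    rw [← Nat.cast_mul, ENNReal.rpow_natCast]
  obtain ⟨m, rfl | rfl⟩ := n.eq_nat_or_neg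
  · rw [map_shift_natCast, Int.cast_natCast, hnat]
  · have h := congrArg (Measure.map (𝒢.shift (-m))) (𝒢.map_shift_natCast μ m)
    rw [Measure.map_map (𝒢.measurable_shift _) (𝒢.measurable_shift _), Measure.map_smul] at h
    have hid : 𝒢.shift (-m) ∘ 𝒢.shift m = id := by
      funext x
      rw [Function.comp_apply, shift_shift, neg_add_cancel, shift_zero, id]
    rw [hid, Measure.map_id, ← hnat] at h
    conv_rhs => rw [h]
    rw [smul_smul, residueCard_rpow_mul_rpow]
    simp

/-- Integrals over a shell are obtained from integrals over the shell of index `0` by scaling. -/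
theorem setLIntegral_shell (μ : Measure G) [μ.IsHaarMeasure] (n : ℤ) (F : G → ℝ≥0∞) :
    ∫⁻ x in 𝒢.shell n, F x ∂μ =
      (residueCard K : ℝ≥0∞) ^ (-((n : ℝ) * homogeneousDim V)) *
        ∫⁻ x in 𝒢.shell 0, F (𝒢.shift n x) ∂μ := by
  have h : ∫⁻ x in 𝒢.shell 0, F (𝒢.shift n x) ∂μ =
      ∫⁻ x in 𝒢.shell n, F x ∂(μ.map (𝒢.shift n)) := by
    rw [← 𝒢.shift_preimage_shell n]
    exact ((𝒢.shift n).toHomeomorph.toMeasurableEquiv.restrict_map μ (𝒢.shell n) ▸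
      (lintegral_map_equiv F (𝒢.shift n).toHomeomorph.toMeasurableEquiv).symm)
  rw [h, 𝒢.map_shift, Measure.restrict_smul, lintegral_smul_measure, smul_eq_mul, ← mul_assoc,
    residueCard_rpow_mul_rpow]
  simp

theorem measure_filtration (μ : Measure G) [μ.IsHaarMeasure] (hμ : μ (𝒢.filtration 0) = 1)
    (n : ℤ) : μ (𝒢.filtration n) =
      (residueCard K : ℝ≥0∞) ^ (-((n : ℝ) * homogeneousDim V)) := by
  have hpre : 𝒢.shift n ⁻¹' 𝒢.filtration n = 𝒢.filtration 0 := by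
    ext x
    have h0 := 𝒢.shift_mem_filtration_iff (m := 0) (n := n) (x := x)
    rwa [add_zero] at h0
  have h := congrArg (fun ν : Measure G => ν (𝒢.filtration n)) (𝒢.map_shift μ n)
  simp only [Measure.smul_apply, Measure.map_apply (𝒢.measurable_shift n)
    (𝒢.measurableSet_filtration _), hpre, hμ, smul_eq_mul] at h
  rw [← mul_one ((residueCard K : ℝ≥0∞) ^ _), h, ← mul_assoc, residueCard_rpow_mul_rpow]
  simp

theorem qnorm_of_mem_shell (μ : Measure G) [μ.IsHaarMeasure] (hμ : μ (𝒢.filtration 0) = 1)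
    {n : ℤ} {x : G} (hx : x ∈ 𝒢.shell n) : 𝒢.qnorm μ x = (residueCard K : ℝ) ^ (-n) := by
  have h : ∃ n : ℤ, x ∈ 𝒢.filtration n \ 𝒢.filtration (n + 1) := ⟨n, hx⟩
  have hn : h.choose = n := by
    by_contra hne
    exact Set.disjoint_left.1 (𝒢.pairwise_disjoint_shell hne) h.choose_spec hx
  have hQ : (homogeneousDim V : ℝ) ≠ 0 := by
    exact_mod_cast (𝒢.homogeneousDim_pos (𝒢.ne_one_of_mem_shell hx)).ne'
  rw [qnorm, dif_pos h, hn, Measure.real, 𝒢.measure_filtration μ hμ,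
    ← ENNReal.toReal_rpow, ENNReal.toReal_natCast, ← Real.rpow_mul (residueCard_pos K).le,
    ← Real.rpow_intCast]
  congr 1
  push_cast
  field_simp

theorem ball_qnorm_of_mem_shell (μ : Measure G) [μ.IsHaarMeasure] (hμ : μ (𝒢.filtration 0) = 1)
    {n : ℤ} {x : G} (hx : x ∈ 𝒢.shell n) : 𝒢.ball μ (𝒢.qnorm μ x) = 𝒢.filtration n := by
  ext z
  rw [ball, Set.mem_ofPred_eq, 𝒢.qnorm_of_mem_shell μ hμ hx]
  rcases eq_or_ne z 1 with rfl | hz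
  · simp only [𝒢.one_mem_filtration, iff_true, qnorm_one]
    exact (zpow_pos (residueCard_pos K) _).le
  · obtain ⟨m, hm⟩ := 𝒢.exists_mem_shell hz
    rw [𝒢.qnorm_of_mem_shell μ hμ hm, 𝒢.mem_filtration_iff_le hm,
      zpow_le_zpow_iff_right₀ (one_lt_residueCard K), neg_le_neg_iff]

end GradedLieGroup

namespace GradedLieGroup

variable {K 𝔤 G : Type*} [Field K] [ValuativeRel K] [TopologicalSpace K]
  [IsNonarchimedeanLocalField K] [LieRing 𝔤] [LieAlgebra K 𝔤] [LieRing.IsNilpotent 𝔤]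
  [TopologicalSpace 𝔤] [IsModuleTopology K 𝔤] [Group G] [TopologicalSpace G]
  [IsTopologicalGroup G] {V : ℕ → Submodule K 𝔤} [GradedLieAlgebra V] {d : ℕ}
  (𝒢 : GradedLieGroup K 𝔤 G V d)

/-! ### Homogeneous weights and integrals over shells -/

variable {𝒢} in
theorem IsHomogeneousWeight.ofReal_shift {S : Set G} {κ : ℝ} {w : G → ℝ}
    (hw : 𝒢.IsHomogeneousWeight S κ w) {n : ℤ} (h0 : 𝒢.shell 0 ⊆ S)
    (hn : 𝒢.shell n ⊆ S) {x : G} (hx : x ∈ 𝒢.shell 0) :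
    ENNReal.ofReal (w (𝒢.shift n x)) =
      (residueCard K : ℝ≥0∞) ^ (-(n * κ)) * ENNReal.ofReal (w x) := by
  have hmem : 𝒢.shift n x ∈ 𝒢.shell n := by
    rw [← 𝒢.shift_preimage_shell n] at hx
    exact hx
  rw [shift_apply, hw.homogeneous _ (uniformizer_zpow_ne_zero n) x
    (𝒢.subset_sdiff_one_of_subset_shell subset_rfl h0 hx) (hn hmem), absK_uniformizer_zpow,
    ← Real.rpow_intCast, ← Real.rpow_mul (residueCard_pos K).le,
    ENNReal.ofReal_mul (Real.rpow_nonneg (residueCard_pos K).le _), ofReal_residueCard_rpow]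
  push_cast
  rw [neg_mul]

variable [MeasurableSpace G] [BorelSpace G]

theorem ae_ne_one (μ : Measure G) [μ.IsHaarMeasure] (hμ : μ (𝒢.filtration 0) = 1)
    (hQ : 0 < homogeneousDim V) : ∀ᵐ x ∂μ, x ≠ 1 := by
  have h : ∀ n : ℕ, μ {1} ≤ ((residueCard K : ℝ≥0∞) ^ (-(homogeneousDim V : ℝ))) ^ n := fun n => by
    calc μ {1} ≤ μ (𝒢.filtration n) :=
          measure_mono (Set.singleton_subset_iff.2 (𝒢.one_mem_filtration _))
      _ = _ := by
          rw [𝒢.measure_filtration μ hμ, ← ENNReal.rpow_natCast, ← ENNReal.rpow_mul]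
          congr 1
          push_cast
          ring
  have hlt : (residueCard K : ℝ≥0∞) ^ (-(homogeneousDim V : ℝ)) < 1 := by
    apply ENNReal.rpow_lt_one_of_one_lt_of_neg
    · exact_mod_cast one_lt_residueCard K
    · simpa using hQ
  have h0 : μ {1} = 0 := le_antisymm
    (ge_of_tendsto' (ENNReal.tendsto_pow_atTop_nhds_zero_of_lt_one hlt) h) zero_le
  rw [ae_iff]
  simpa using h0

theorem setLIntegral_eq_tsum_shell (μ : Measure G) [μ.IsHaarMeasure]
    (hμ : μ (𝒢.filtration 0) = 1) (hQ : 0 < homogeneousDim V) {S : Set G} (hS : MeasurableSet S)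
    (F : G → ℝ≥0∞) :
    ∫⁻ x in S, F x ∂μ = ∑' n : ℤ, ∫⁻ x in S ∩ 𝒢.shell n, F x ∂μ := by
  rw [← lintegral_iUnion (fun n => hS.inter (𝒢.measurableSet_shell n))
    fun m n hmn => (𝒢.pairwise_disjoint_shell hmn).mono Set.inter_subset_right
      Set.inter_subset_right]
  refine setLIntegral_congr ?_
  filter_upwards [𝒢.ae_ne_one μ hμ hQ] with x hx
  obtain ⟨n, hn⟩ := 𝒢.exists_mem_shell hx
  refine propext ⟨fun h => Set.mem_iUnion.2 ⟨n, h, hn⟩, fun h => ?_⟩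
  obtain ⟨m, hm⟩ := Set.mem_iUnion.1 h
  exact hm.1

theorem setLIntegral_inter_filtration (μ : Measure G) [μ.IsHaarMeasure]
    (hμ : μ (𝒢.filtration 0) = 1) (hQ : 0 < homogeneousDim V) {S : Set G} (hS : MeasurableSet S)
    (F : G → ℝ≥0∞) (n : ℤ) :
    ∫⁻ x in S ∩ 𝒢.filtration n, F x ∂μ = ∑' j : ℕ, ∫⁻ x in S ∩ 𝒢.shell (n + j), F x ∂μ := by
  rw [← lintegral_iUnion (fun j => hS.inter (𝒢.measurableSet_shell _))
    fun i j hij => (𝒢.pairwise_disjoint_shell (by simpa using hij)).mono Set.inter_subset_right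
      Set.inter_subset_right]
  refine setLIntegral_congr ?_
  filter_upwards [𝒢.ae_ne_one μ hμ hQ] with x hx
  obtain ⟨m, hm⟩ := 𝒢.exists_mem_shell hx
  refine propext ⟨fun h => ?_, fun h => ?_⟩
  · have hle := (𝒢.mem_filtration_iff_le hm).1 h.2
    refine Set.mem_iUnion.2 ⟨(m - n).toNat, h.1, ?_⟩
    rwa [Int.toNat_of_nonneg (by omega), add_sub_cancel]
  · obtain ⟨j, hj⟩ := Set.mem_iUnion.1 h
    exact ⟨hj.1, 𝒢.filtration_anti (by omega) hj.2.1⟩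

section Weight

variable {𝒢} {S : Set G} {κ : ℝ} {w : G → ℝ}

theorem IsHomogeneousWeight.aemeasurable (hw : 𝒢.IsHomogeneousWeight S κ w) (μ : Measure G)
    (hS : MeasurableSet S) (n : ℤ) :
    AEMeasurable (fun x => ENNReal.ofReal (w x)) (μ.restrict (S ∩ 𝒢.shell n)) :=
  ((hw.continuousOn.mono (𝒢.subset_sdiff_one_of_subset_shell Set.inter_subset_right
    Set.inter_subset_left)).aemeasurable (hS.inter (𝒢.measurableSet_shell n))).ennreal_ofReal

theorem IsHomogeneousWeight.setLIntegral_shell_rpow (hw : 𝒢.IsHomogeneousWeight S κ w)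
    (μ : Measure G) [μ.IsHaarMeasure] {n : ℤ} (h0 : 𝒢.shell 0 ⊆ S) (hn : 𝒢.shell n ⊆ S) (p : ℝ) :
    ∫⁻ x in 𝒢.shell n, ENNReal.ofReal (w x) ^ p ∂μ =
      (residueCard K : ℝ≥0∞) ^ (-(n * (homogeneousDim V + κ * p))) *
        ∫⁻ x in 𝒢.shell 0, ENNReal.ofReal (w x) ^ p ∂μ := by
  rw [𝒢.setLIntegral_shell μ n, setLIntegral_congr_fun (g := fun x =>
    (residueCard K : ℝ≥0∞) ^ (-(n * κ) * p) * ENNReal.ofReal (w x) ^ p) (𝒢.measurableSet_shell 0),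
    lintegral_const_mul' _ _ (residueCard_rpow_ne_top K _), ← mul_assoc, residueCard_rpow_mul_rpow]
  · congr 2
    ring
  · intro x hx
    dsimp only
    rw [hw.ofReal_shift h0 hn hx, ENNReal.mul_rpow_of_ne_top (residueCard_rpow_ne_top K _)
      ENNReal.ofReal_ne_top, ← ENNReal.rpow_mul]

theorem IsHomogeneousWeight.setLIntegral_shell (hw : 𝒢.IsHomogeneousWeight S κ w)
    (μ : Measure G) [μ.IsHaarMeasure] {n : ℤ} (h0 : 𝒢.shell 0 ⊆ S) (hn : 𝒢.shell n ⊆ S) :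
    ∫⁻ x in 𝒢.shell n, ENNReal.ofReal (w x) ∂μ =
      (residueCard K : ℝ≥0∞) ^ (-(n * (homogeneousDim V + κ))) *
        ∫⁻ x in 𝒢.shell 0, ENNReal.ofReal (w x) ∂μ := by
  simpa using hw.setLIntegral_shell_rpow μ h0 hn 1

theorem IsHomogeneousWeight.setLIntegral_shell_ne_top (hw : 𝒢.IsHomogeneousWeight S κ w)
    (μ : Measure G) [μ.IsHaarMeasure] {n : ℤ} (hn : 𝒢.shell n ⊆ S) :
    ∫⁻ x in 𝒢.shell n, ENNReal.ofReal (w x) ∂μ ≠ ∞ := by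
  obtain ⟨C, hC⟩ := (𝒢.isCompact_shell n).exists_bound_of_continuousOn
    (hw.continuousOn.mono (𝒢.subset_sdiff_one_of_subset_shell subset_rfl hn))
  have h : ∫⁻ x in 𝒢.shell n, ENNReal.ofReal (w x) ∂μ ≤
      ∫⁻ _ in 𝒢.shell n, ENNReal.ofReal C ∂μ :=
    setLIntegral_mono' (𝒢.measurableSet_shell n) fun x hx =>
      ENNReal.ofReal_le_ofReal ((le_abs_self _).trans (hC x hx))
  refine ne_top_of_le_ne_top ?_ h
  rw [setLIntegral_const]
  exact ENNReal.mul_ne_top ENNReal.ofReal_ne_top (𝒢.isCompact_shell n).measure_ne_top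

/-- By homogeneity a weight that is positive somewhere on `S` is not null on the shell of index
`0`. -/
theorem IsHomogeneousWeight.setLIntegral_shell_zero_ne_zero (hw : 𝒢.IsHomogeneousWeight S κ w)
    (μ : Measure G) [μ.IsHaarMeasure] (h0 : 𝒢.shell 0 ⊆ S)
    (hS : ∀ n, 𝒢.shell n ⊆ S ∨ Disjoint (𝒢.shell n) S) (hx : ∃ x ∈ S, x ≠ 1 ∧ w x ≠ 0) :
    ∫⁻ x in 𝒢.shell 0, ENNReal.ofReal (w x) ∂μ ≠ 0 := by
  obtain ⟨x, hxS, hx1, hwx⟩ := hx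
  obtain ⟨n, hn⟩ := 𝒢.exists_mem_shell hx1
  have hnS := (hS n).resolve_right fun h => Set.disjoint_left.1 h hn hxS
  have hpos : 0 < w x := lt_of_le_of_ne (hw.nonneg x ⟨hxS, hx1⟩) hwx.symm
  have hopen : IsOpen (𝒢.shell n ∩ w ⁻¹' Set.Ioi (w x / 2)) :=
    (hw.continuousOn.mono (𝒢.subset_sdiff_one_of_subset_shell subset_rfl hnS)).isOpen_inter_preimage
      (𝒢.isOpen_shell n) isOpen_Ioi
  set U := 𝒢.shell n ∩ w ⁻¹' Set.Ioi (w x / 2)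
  have hU : μ U ≠ 0 := (hopen.measure_pos μ ⟨x, hn, half_lt_self hpos⟩).ne'
  have hle : ENNReal.ofReal (w x / 2) * μ U ≤ ∫⁻ x in 𝒢.shell n, ENNReal.ofReal (w x) ∂μ := by
    rw [← setLIntegral_const]
    exact (setLIntegral_mono' hopen.measurableSet fun y hy =>
      ENNReal.ofReal_le_ofReal (le_of_lt hy.2)).trans (lintegral_mono_set Set.inter_subset_left)
  intro hzero
  rw [hw.setLIntegral_shell μ h0 hnS, hzero, mul_zero, nonpos_iff_eq_zero, mul_eq_zero] at hle
  rcases hle with h | h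
  · rw [ENNReal.ofReal_eq_zero] at h
    linarith
  · exact hU h

end Weight

/-! ### The Hardy inequality -/

/-- Sufficiency: on each shell Hölder's inequality reduces the claim to the discrete Hardy
inequality for the sequence of the norms of `f` on the shells. -/
theorem hardyInequality_of_eq (μ : Measure G) [μ.IsHaarMeasure] (hμ : μ (𝒢.filtration 0) = 1)
    (hQ : 0 < homogeneousDim V) {S : Set G} (hSm : MeasurableSet S) (h0 : 𝒢.shell 0 ⊆ S)
    (hS : ∀ n, 𝒢.shell n ⊆ S ∨ Disjoint (𝒢.shell n) S) {r r' s α β : ℝ}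
    (hr : r.HolderConjugate r') (hrs : r ≤ s) (hβ : β < (homogeneousDim V : ℝ) / (r' - 1))
    {φ ψ : G → ℝ} (hφ : 𝒢.IsHomogeneousWeight S (-α) φ) (hψ : 𝒢.IsHomogeneousWeight S β ψ)
    (hfin : ∫⁻ x in 𝒢.shell 0, ENNReal.ofReal (ψ x) ^ (1 - r') ∂μ ≠ ∞)
    (heq : (α - homogeneousDim V) / s = homogeneousDim V / r' - β / r) :
    𝒢.HardyInequality μ S r s φ ψ := by
  set q : ℝ≥0∞ := (residueCard K : ℝ≥0∞) with hq
  set Q : ℝ := (homogeneousDim V : ℝ)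
  set δ : ℝ := Q / r' - β / r with hδ
  have hr0 : 0 < r := hr.pos
  have hr1 : 1 < r := hr.lt
  have hr'0 : 0 < r' := hr.symm.pos
  have hr'1 : 1 < r' := hr.symm.lt
  have hs0 : 0 < s := hr0.trans_le hrs
  -- `ψ ^ (1 - r')` has degree `-β (r' - 1)`, so its integral over `A_n` scales as `q ^ (-n δ r')`.
  have hδr' : δ * r' = Q - β * (r' - 1) := by
    have h1 : r' / r = r' - 1 := (div_eq_iff hr0.ne').2 hr.symm.sub_one_mul_conj.symm
    rw [hδ, sub_mul, div_mul_cancel₀ _ hr'0.ne', ← h1]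
    ring
  have hδpos : 0 < δ := by
    rw [lt_div_iff₀ (by linarith)] at hβ
    exact pos_of_mul_pos_left (by rw [hδr']; linarith) hr'0.le
  have hδs : α - Q = δ * s := by rw [← heq]; field_simp
  set Φ := ∫⁻ x in 𝒢.shell 0, ENNReal.ofReal (φ x) ∂μ
  set Ψ := ∫⁻ x in 𝒢.shell 0, ENNReal.ofReal (ψ x) ^ (1 - r') ∂μ
  have hΦ : Φ ≠ ∞ := hφ.setLIntegral_shell_ne_top μ h0
  set t : ℝ≥0∞ := q ^ (-δ) with ht
  have ht1 : t < 1 := ENNReal.rpow_lt_one_of_one_lt_of_neg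
    (by rw [hq]; exact_mod_cast one_lt_residueCard K) (by linarith)
  set C := (Φ * Ψ ^ (s / r')) ^ (1 / s) * ∑' j : ℕ, t ^ j
  have hC : C ≠ ∞ := by
    refine ENNReal.mul_ne_top (ENNReal.rpow_ne_top_of_nonneg (by positivity)
      (ENNReal.mul_ne_top hΦ (ENNReal.rpow_ne_top_of_nonneg (by positivity) hfin))) ?_
    rw [ENNReal.tsum_geometric]
    exact ENNReal.inv_ne_top.2 (tsub_pos_of_lt ht1).ne'
  refine ⟨C.toReal + 1, by positivity, fun f hf _ => ?_⟩
  have hCle : C ≤ ENNReal.ofReal (C.toReal + 1) :=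
    (ENNReal.ofReal_toReal hC).symm.le.trans (ENNReal.ofReal_le_ofReal (by linarith))
  refine le_trans ?_ (mul_le_mul_left hCle _)
  set b : ℤ → ℝ≥0∞ := fun n =>
    (∫⁻ x in S ∩ 𝒢.shell n, ENNReal.ofReal (f x) ^ r * ENNReal.ofReal (ψ x) ∂μ) ^ (1 / r)
  have hf_shell : ∀ n, ∫⁻ x in S ∩ 𝒢.shell n, ENNReal.ofReal (f x) ∂μ ≤
      Ψ ^ (1 / r') * q ^ (-(n * δ)) * b n := by
    intro n
    rcases hS n with hn | hn
    · have hψn := hψ.aemeasurable μ hSm n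
      have hfn := (hf.mono_measure (Measure.restrict_mono_set μ
        (Set.inter_subset_left : S ∩ 𝒢.shell n ⊆ S))).ennreal_ofReal
      have hint := hψ.setLIntegral_shell_rpow μ h0 hn (1 - r')
      simp only [b]
      rw [Set.inter_eq_right.2 hn] at hψn hfn ⊢
      refine (lintegral_le_rpow_mul_rpow_weight hfn hψn (fun _ => ENNReal.ofReal_ne_top) hr
        ?_).trans_eq ?_
      · rw [hint]
        exact ENNReal.mul_ne_top (residueCard_rpow_ne_top K _) hfin
      · rw [hint, ENNReal.mul_rpow_of_nonneg _ _ (by positivity), ← ENNReal.rpow_mul,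
          mul_comm _ (Ψ ^ (1 / r')), mul_comm]
        congr 3
        rw [mul_one_div, div_eq_iff hr'0.ne', neg_mul, mul_assoc, hδr']
        ring
    · simp [hn.symm.inter_eq]
  have hφ_shell : ∀ n : ℤ, ∫⁻ x in S ∩ 𝒢.shell n, ENNReal.ofReal (φ x) ∂μ ≤
      q ^ (n * δ * s) * Φ := by
    intro n
    rcases hS n with hn | hn
    · rw [Set.inter_eq_right.2 hn, hφ.setLIntegral_shell μ h0 hn]
      refine le_of_eq ?_
      congr 2
      rw [mul_assoc, ← hδs]
      ring
    · simp [hn.symm.inter_eq]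
  have hball : ∀ n : ℤ, ∫⁻ z in S ∩ 𝒢.filtration n, ENNReal.ofReal (f z) ∂μ ≤
      Ψ ^ (1 / r') * q ^ (-(n * δ)) * ∑' j : ℕ, t ^ j * b (n + j) := by
    intro n
    rw [𝒢.setLIntegral_inter_filtration μ hμ hQ hSm, ← ENNReal.tsum_mul_left]
    refine ENNReal.tsum_le_tsum fun j => (hf_shell _).trans_eq ?_
    rw [← mul_assoc, mul_assoc (Ψ ^ (1 / r')) _ (t ^ j), ht, ← ENNReal.rpow_natCast,
      ← ENNReal.rpow_mul, hq, residueCard_rpow_mul_rpow]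
    congr 3
    push_cast
    ring
  have hterm : ∀ n : ℤ, ∫⁻ x in S ∩ 𝒢.shell n,
      (∫⁻ z in S ∩ 𝒢.ball μ (𝒢.qnorm μ x), ENNReal.ofReal (f z) ∂μ) ^ s *
        ENNReal.ofReal (φ x) ∂μ ≤
      Φ * Ψ ^ (s / r') * (∑' j : ℕ, t ^ j * b (n + j)) ^ s := by
    intro n
    rw [setLIntegral_congr_fun (g := fun x =>
      (∫⁻ z in S ∩ 𝒢.filtration n, ENNReal.ofReal (f z) ∂μ) ^ s * ENNReal.ofReal (φ x))
      (hSm.inter (𝒢.measurableSet_shell n))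
      fun x hx => by dsimp only; rw [𝒢.ball_qnorm_of_mem_shell μ hμ hx.2],
      lintegral_const_mul'' _ (hφ.aemeasurable μ hSm n)]
    calc _ ≤ (Ψ ^ (1 / r') * q ^ (-(n * δ)) * ∑' j : ℕ, t ^ j * b (n + j)) ^ s *
          (q ^ (n * δ * s) * Φ) := by
          gcongr
          · exact hball n
          · exact hφ_shell n
      _ = Φ * Ψ ^ (s / r') * (∑' j : ℕ, t ^ j * b (n + j)) ^ s *
          (q ^ (-(n * δ) * s) * q ^ (n * δ * s)) := by
          rw [ENNReal.mul_rpow_of_nonneg _ _ hs0.le, ENNReal.mul_rpow_of_nonneg _ _ hs0.le,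
            ← ENNReal.rpow_mul, ← ENNReal.rpow_mul, one_div_mul_eq_div]
          ring
      _ = _ := by
          rw [hq, residueCard_rpow_mul_rpow, neg_mul, neg_add_cancel, ENNReal.rpow_zero, mul_one]
  have hb : ∑' n, b n ^ r =
      ∫⁻ x in S, ENNReal.ofReal (f x) ^ r * ENNReal.ofReal (ψ x) ∂μ := by
    rw [𝒢.setLIntegral_eq_tsum_shell μ hμ hQ hSm]
    refine tsum_congr fun n => ?_
    rw [← ENNReal.rpow_mul, one_div_mul_cancel hr0.ne', ENNReal.rpow_one]
  rw [𝒢.setLIntegral_eq_tsum_shell μ hμ hQ hSm, ← hb]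
  calc _ ≤ (∑' n : ℤ, Φ * Ψ ^ (s / r') * (∑' j : ℕ, t ^ j * b (n + j)) ^ s) ^ (1 / s) :=
        ENNReal.rpow_le_rpow (ENNReal.tsum_le_tsum hterm) (by positivity)
    _ = (Φ * Ψ ^ (s / r')) ^ (1 / s) *
        (∑' n : ℤ, (∑' j : ℕ, t ^ j * b (n + j)) ^ s) ^ (1 / s) := by
        rw [ENNReal.tsum_mul_left, ENNReal.mul_rpow_of_nonneg _ _ (by positivity)]
    _ ≤ (Φ * Ψ ^ (s / r')) ^ (1 / s) * ((∑' j : ℕ, t ^ j) * (∑' n, b n ^ r) ^ (1 / r)) := by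
        gcongr
        exact tsum_rpow_geometric_le b t hr1 hrs
    _ = _ := by rw [← mul_assoc]

/-- Necessity: the inequality for the indicator functions of the shells bounds the powers of `q`
whose exponent measures the failure of the identity between the parameters. -/
theorem exists_rpow_le_of_hardyInequality (μ : Measure G) [μ.IsHaarMeasure]
    (hμ : μ (𝒢.filtration 0) = 1) {S : Set G} (h0 : 𝒢.shell 0 ⊆ S)
    (hS : ∀ n, 𝒢.shell n ⊆ S ∨ Disjoint (𝒢.shell n) S) {r r' s α β : ℝ}
    (hr : r.HolderConjugate r') (hrs : r ≤ s)
    {φ ψ : G → ℝ} (hφ : 𝒢.IsHomogeneousWeight S (-α) φ) (hψ : 𝒢.IsHomogeneousWeight S β ψ)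
    (hφ0 : ∃ x ∈ S, x ≠ 1 ∧ φ x ≠ 0) (h : 𝒢.HardyInequality μ S r s φ ψ) :
    ∃ M : ℝ, ∀ n : ℤ, 𝒢.shell n ⊆ S →
      (residueCard K : ℝ) ^
        (n * ((α - homogeneousDim V) / s - (homogeneousDim V / r' - β / r))) ≤ M := by
  obtain ⟨C, -, hC⟩ := h
  set q : ℝ≥0∞ := (residueCard K : ℝ≥0∞) with hq
  set Q : ℝ := (homogeneousDim V : ℝ)
  have hr0 : 0 < r := hr.pos
  have hs0 : 0 < s := hr0.trans_le hrs
  set Φ := ∫⁻ x in 𝒢.shell 0, ENNReal.ofReal (φ x) ∂μ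
  set Ψ := ∫⁻ x in 𝒢.shell 0, ENNReal.ofReal (ψ x) ∂μ
  have hΦ0 : Φ ≠ 0 := hφ.setLIntegral_shell_zero_ne_zero μ h0 hS hφ0
  have hΦ : Φ ≠ ∞ := hφ.setLIntegral_shell_ne_top μ h0
  have hΨ : Ψ ≠ ∞ := hψ.setLIntegral_shell_ne_top μ h0
  have hm0 : μ (𝒢.shell 0) ≠ 0 := fun hz => hΦ0 (setLIntegral_measure_zero _ _ hz)
  set A := μ (𝒢.shell 0) * Φ ^ (1 / s)
  set B := ENNReal.ofReal C * Ψ ^ (1 / r)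
  have hA : A ≠ 0 := mul_ne_zero hm0 (by simp [ENNReal.rpow_eq_zero_iff, hΦ0, hΦ])
  have hA' : A ≠ ∞ := ENNReal.mul_ne_top (𝒢.isCompact_shell 0).measure_ne_top
    (ENNReal.rpow_ne_top_of_nonneg (by positivity) hΦ)
  have hB : B ≠ ∞ := ENNReal.mul_ne_top ENNReal.ofReal_ne_top
    (ENNReal.rpow_ne_top_of_nonneg (by positivity) hΨ)
  refine ⟨(B / A).toReal, fun n hn => ?_⟩
  rw [← ENNReal.ofReal_le_iff_le_toReal (ENNReal.div_ne_top hB hA), ofReal_residueCard_rpow,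
    ENNReal.le_div_iff_mul_le (Or.inl hA) (Or.inl hA')]
  set f : G → ℝ := (𝒢.shell n).indicator 1
  have hf_ofReal : ∀ x, ENNReal.ofReal (f x) = (𝒢.shell n).indicator 1 x := fun x => by
    by_cases hx : x ∈ 𝒢.shell n <;> simp [f, hx]
  have hle := hC f (measurable_one.indicator (𝒢.measurableSet_shell n)).aemeasurable
    (Filter.Eventually.of_forall fun x => Set.indicator_nonneg (fun _ _ => zero_le_one) x)
  have hshell : μ (𝒢.shell n) = q ^ (-(n * Q)) * μ (𝒢.shell 0) := by
    simpa using 𝒢.setLIntegral_shell μ n 1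
  have hleft : q ^ (-(n * Q)) * q ^ (n * ((α - Q) / s)) * A ≤
      (∫⁻ x in S, (∫⁻ z in S ∩ 𝒢.ball μ (𝒢.qnorm μ x), ENNReal.ofReal (f z) ∂μ) ^ s *
        ENNReal.ofReal (φ x) ∂μ) ^ (1 / s) := by
    have hinner : ∀ x ∈ 𝒢.shell n, μ (𝒢.shell n) ≤
        ∫⁻ z in S ∩ 𝒢.ball μ (𝒢.qnorm μ x), ENNReal.ofReal (f z) ∂μ := fun x hx => by
      rw [𝒢.ball_qnorm_of_mem_shell μ hμ hx]
      calc μ (𝒢.shell n) = ∫⁻ z in 𝒢.shell n, ENNReal.ofReal (f z) ∂μ := by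
            simp only [hf_ofReal]
            rw [lintegral_indicator_one (𝒢.measurableSet_shell n), Measure.restrict_apply_self]
        _ ≤ _ := lintegral_mono_set (Set.subset_inter hn Set.sdiff_subset)
    calc q ^ (-(n * Q)) * q ^ (n * ((α - Q) / s)) * A
        = (μ (𝒢.shell n) ^ s * ∫⁻ x in 𝒢.shell n, ENNReal.ofReal (φ x) ∂μ) ^ (1 / s) := by
          rw [hφ.setLIntegral_shell μ h0 hn, ENNReal.mul_rpow_of_nonneg _ _ (by positivity),
            ENNReal.mul_rpow_of_nonneg _ _ (by positivity), ← ENNReal.rpow_mul, ← ENNReal.rpow_mul,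
            mul_one_div_cancel hs0.ne', ENNReal.rpow_one, hshell,
            show -(n * (Q + -α)) * (1 / s) = n * ((α - Q) / s) by ring]
          simp only [A]
          ring
      _ = (∫⁻ x in 𝒢.shell n, μ (𝒢.shell n) ^ s * ENNReal.ofReal (φ x) ∂μ) ^ (1 / s) := by
          rw [lintegral_const_mul' _ _ (ENNReal.rpow_ne_top_of_nonneg hs0.le
            (𝒢.isCompact_shell n).measure_ne_top)]
      _ ≤ (∫⁻ x in 𝒢.shell n,
            (∫⁻ z in S ∩ 𝒢.ball μ (𝒢.qnorm μ x), ENNReal.ofReal (f z) ∂μ) ^ s *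
              ENNReal.ofReal (φ x) ∂μ) ^ (1 / s) := by
          refine ENNReal.rpow_le_rpow (setLIntegral_mono' (𝒢.measurableSet_shell n)
            fun x hx => ?_) (by positivity)
          gcongr
          exact hinner x hx
      _ ≤ _ := ENNReal.rpow_le_rpow (lintegral_mono_set hn) (by positivity)
  have hright : (∫⁻ x in S, ENNReal.ofReal (f x) ^ r * ENNReal.ofReal (ψ x) ∂μ) ^ (1 / r) ≤
      q ^ (-(n * (Q + β)) * (1 / r)) * Ψ ^ (1 / r) := by
    have hind : ∀ x, ENNReal.ofReal (f x) ^ r * ENNReal.ofReal (ψ x) =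
        (𝒢.shell n).indicator (fun x => ENNReal.ofReal (ψ x)) x := fun x => by
      rw [hf_ofReal]
      by_cases hx : x ∈ 𝒢.shell n <;> simp [hx, hr0]
    rw [ENNReal.rpow_mul, ← ENNReal.mul_rpow_of_nonneg _ _ (by positivity),
      ← hψ.setLIntegral_shell μ h0 hn]
    refine ENNReal.rpow_le_rpow ?_ (by positivity)
    simp only [hind]
    refine (setLIntegral_le_lintegral _ _).trans_eq ?_
    rw [lintegral_indicator (𝒢.measurableSet_shell n)]
  have hexp : n * ((α - Q) / s - (Q / r' - β / r)) =
      n * (Q + β) * (1 / r) + (-(n * Q) + n * ((α - Q) / s)) := by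
    have h1 : r'⁻¹ = 1 - r⁻¹ := eq_sub_of_add_eq' hr.inv_add_inv_eq_one
    have h2 : Q / r' = Q - Q / r := by
      rw [div_eq_mul_inv, div_eq_mul_inv, h1]
      ring
    rw [h2]
    ring
  calc q ^ (n * ((α - Q) / s - (Q / r' - β / r))) * A
      = q ^ (n * (Q + β) * (1 / r)) * (q ^ (-(n * Q)) * q ^ (n * ((α - Q) / s)) * A) := by
        rw [hexp, hq, ← residueCard_rpow_mul_rpow, ← residueCard_rpow_mul_rpow]
        ring
    _ ≤ q ^ (n * (Q + β) * (1 / r)) *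
        (ENNReal.ofReal C * (q ^ (-(n * (Q + β)) * (1 / r)) * Ψ ^ (1 / r))) := by
        exact mul_le_mul' le_rfl (hleft.trans (hle.trans (mul_le_mul' le_rfl hright)))
    _ = q ^ (n * (Q + β) * (1 / r)) * q ^ (-(n * (Q + β)) * (1 / r)) * B := by
        simp only [B]
        ring
    _ = B := by
        rw [hq, residueCard_rpow_mul_rpow, neg_mul, add_neg_cancel, ENNReal.rpow_zero, one_mul]

end GradedLieGroup

theorem nonpos_of_forall_rpow_le {q y M : ℝ} (hq : 1 < q) (h : ∀ n : ℕ, q ^ (n * y) ≤ M) :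
    y ≤ 0 := by
  by_contra! hy
  obtain ⟨n, hn⟩ := pow_unbounded_of_one_lt M (Real.one_lt_rpow hq hy)
  have := h n
  rw [mul_comm, Real.rpow_mul (by linarith), Real.rpow_natCast] at this
  linarith

end GradedHardy

theorem mainTheorem8
    {K 𝔤 G : Type*} [Field K] [ValuativeRel K] [TopologicalSpace K]
    [IsNonarchimedeanLocalField K]
    [LieRing 𝔤] [LieAlgebra K 𝔤] [LieRing.IsNilpotent 𝔤]
    [TopologicalSpace 𝔤] [IsModuleTopology K 𝔤]
    [Group G] [TopologicalSpace G] [IsTopologicalGroup G] [MeasurableSpace G] [BorelSpace G]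
    (V : ℕ → Submodule K 𝔤) [GradedLieAlgebra V] (d : ℕ)
    (𝒢 : GradedHardy.GradedLieGroup K 𝔤 G V d)
    (μ : Measure G) [μ.IsHaarMeasure] (hμ : μ (𝒢.filtration 0) = 1)
    (r r' s α β : ℝ) (hr : r.HolderConjugate r') (hrs : r ≤ s)
    (hα : (GradedHardy.homogeneousDim V : ℝ) < α)
    (hβ : β < (GradedHardy.homogeneousDim V : ℝ) / (r' - 1)) :
    (∀ φ ψ : G → ℝ, 0 ≤ β →
      𝒢.IsHomogeneousWeight Set.univ (-α) φ → 𝒢.IsHomogeneousWeight Set.univ β ψ →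
      (∃ x, x ≠ 1 ∧ φ x ≠ 0) →
      (∫⁻ x in 𝒢.filtration 0 \ 𝒢.filtration 1, ENNReal.ofReal (ψ x) ^ (1 - r') ∂μ) < ∞ →
      (𝒢.HardyInequality μ Set.univ r s φ ψ ↔
        (α - GradedHardy.homogeneousDim V) / s =
          GradedHardy.homogeneousDim V / r' - β / r)) ∧
    (∀ φ ψ : G → ℝ,
      𝒢.IsHomogeneousWeight (𝒢.filtration 0) (-α) φ →
      𝒢.IsHomogeneousWeight (𝒢.filtration 0) β ψ →
      (∃ x ∈ 𝒢.filtration 0, x ≠ 1 ∧ φ x ≠ 0) →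
      (∫⁻ x in 𝒢.filtration 0 \ 𝒢.filtration 1, ENNReal.ofReal (ψ x) ^ (1 - r') ∂μ) < ∞ →
      ((α - GradedHardy.homogeneousDim V) / s = GradedHardy.homogeneousDim V / r' - β / r →
        𝒢.HardyInequality μ (𝒢.filtration 0) r s φ ψ) ∧
      (𝒢.HardyInequality μ (𝒢.filtration 0) r s φ ψ →
        (α - GradedHardy.homogeneousDim V) / s ≤
          GradedHardy.homogeneousDim V / r' - β / r)) := by
  have hq := GradedHardy.one_lt_residueCard K
  have huniv : ∀ n, 𝒢.shell n ⊆ Set.univ := fun n => Set.subset_univ _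
  have hG0 : ∀ n : ℤ, 0 ≤ n → 𝒢.shell n ⊆ 𝒢.filtration 0 := fun n hn x hx =>
    𝒢.filtration_anti hn hx.1
  have hG0' : ∀ n, 𝒢.shell n ⊆ 𝒢.filtration 0 ∨ Disjoint (𝒢.shell n) (𝒢.filtration 0) := by
    intro n
    rcases le_or_gt 0 n with hn | hn
    · exact Or.inl (hG0 n hn)
    · exact Or.inr (Set.disjoint_left.2 fun x hx h0 =>
        absurd ((𝒢.mem_filtration_iff_le hx).1 h0) (not_le.2 hn))
  have hshell : 𝒢.filtration 0 \ 𝒢.filtration 1 = 𝒢.shell 0 := by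
    rw [GradedHardy.GradedLieGroup.shell, zero_add]
  rw [hshell]
  refine ⟨fun φ ψ _ hφ hψ hφ0 hfin => ⟨fun h => ?_, fun heq => ?_⟩,
    fun φ ψ hφ hψ hφ0 hfin => ⟨fun heq => ?_, fun h => ?_⟩⟩
  · obtain ⟨x, hx1, hx⟩ := hφ0
    obtain ⟨M, hM⟩ := 𝒢.exists_rpow_le_of_hardyInequality μ hμ (huniv 0)
      (fun n => Or.inl (huniv n)) hr hrs hφ hψ ⟨x, Set.mem_univ x, hx1, hx⟩ h
    -- On the whole group the shells are indexed by all integers, so that `n → ∞` gives one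
    -- inequality and `n → -∞` the other one.
    refine le_antisymm ?_ ?_
    · exact sub_nonpos.1 (GradedHardy.nonpos_of_forall_rpow_le hq fun n =>
        by simpa using hM n (huniv _))
    · refine sub_nonpos.1 (GradedHardy.nonpos_of_forall_rpow_le (M := M) hq fun n => ?_)
      refine le_of_eq_of_le ?_ (hM (-n) (huniv _))
      congr 1
      push_cast
      ring
  · obtain ⟨x, hx1, -⟩ := hφ0
    exact 𝒢.hardyInequality_of_eq μ hμ (𝒢.homogeneousDim_pos hx1) MeasurableSet.univ (huniv 0)
      (fun n => Or.inl (huniv n)) hr hrs hβ hφ hψ hfin.ne heq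
  · obtain ⟨x, -, hx1, -⟩ := hφ0
    exact 𝒢.hardyInequality_of_eq μ hμ (𝒢.homogeneousDim_pos hx1) (𝒢.measurableSet_filtration 0)
      (hG0 0 le_rfl) hG0' hr hrs hβ hφ hψ hfin.ne heq
  · obtain ⟨M, hM⟩ := 𝒢.exists_rpow_le_of_hardyInequality μ hμ (hG0 0 le_rfl) hG0' hr hrs hφ hψ
      hφ0 h
    exact sub_nonpos.1 (GradedHardy.nonpos_of_forall_rpow_le hq fun n =>
      by simpa using hM n (hG0 n (Int.natCast_nonneg n)))
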